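/- Let $k$ be a perfect field and let $f\colon X\to Y$ be a quasi-finite morphism of schemes over $k$ (i.e. $f$ is of finite type and every point of $X$ is isolated in its fiber), with $X$ separated and quasi-compact. For a scheme $Z$ over $k$ let $Z_\infty$ denote its arc space over $k$, i.e. the $k$-scheme that represents the functor $B\mapsto\varprojlim_m \operatorname{Hom}_k(\operatorname{Spec} B[t]/(t^{m+1}),Z)$ on $k$-algebras, and let $f_\infty\colon X_\infty\to Y_\infty$ be the morphism induced by $f$. Let $R=\operatorname{Supp}\Omega_{X/Y}\subset X$ be the ramification locus of $f$; it is closed in $X$, and it is regarded as a closed subscheme of $X$ with any scheme structure supported on it. Then: (1) there is an integer $d\ge 0$ such that for every point $\beta\in Y_\infty$ the underlying topological space of the fiber $f_\infty^{-1}(\beta)$ is finite and discrete, with at most $d$ points; (2) the complement in $X_\infty$ of the image of $R_\infty\to X_\infty$ is open, and the restriction of $f_\infty$ to this open subscheme $X_\infty\setminus R_\infty$ has finite reduced fibers: for every $\beta\in Y_\infty$ its scheme-theoretic fiber over $\beta$ is a reduced scheme that is finite over the residue field of $\beta$. -/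

import Mathlib

universe u
open CategoryTheory Limits Opposite AlgebraicGeometry
open scoped Polynomial PowerSeries
noncomputable section
namespace ArcScheme

/-- The truncated polynomial ring `B[t] / (t ^ (m + 1))`. -/
abbrev TruncPoly (B : Type u) [CommRing B] (m : ℕ) : Type u :=
  B[X] ⧸ Ideal.span {(Polynomial.X : B[X]) ^ (m + 1)}

/-- The projection `B[t] / (t ^ (m + 2)) → B[t] / (t ^ (m + 1))`. -/
def truncPolyProj (B : Type u) [CommRing B] (m : ℕ) : TruncPoly B (m + 1) →+* TruncPoly B m :=
  Ideal.Quotient.factor <| by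
    rw [Ideal.span_singleton_le_span_singleton]
    exact pow_dvd_pow _ (Nat.le_succ _)

/- Algebraic preparations for the existence of arc spaces: truncations of power series and the ring of
Hasse–Schmidt higher derivations. They enter only the proof that the functor of arcs is
representable. -/
section Algebra

variable {A B C : Type u} [CommRing A] [CommRing B] [CommRing C]

lemma truncPoly_mk_eq_iff (m : ℕ) (p q : B[X]) :
    (Ideal.Quotient.mk _ p : TruncPoly B m) = Ideal.Quotient.mk _ q ↔
      ∀ i ≤ m, p.coeff i = q.coeff i := by
  rw [Ideal.Quotient.mk_eq_mk_iff_sub_mem, Ideal.mem_span_singleton, Polynomial.X_pow_dvd_iff]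
  simp [sub_eq_zero]

/-- Truncation of power series. -/
def truncHom (B : Type u) [CommRing B] (m : ℕ) : B⟦X⟧ →+* TruncPoly B m where
  toFun p := Ideal.Quotient.mk _ (PowerSeries.trunc (m + 1) p)
  map_one' := by
    rw [← map_one (Ideal.Quotient.mk _), truncPoly_mk_eq_iff]
    intro i hi
    simp [Polynomial.coeff_one]
  map_zero' := by simp
  map_add' := by simp
  map_mul' p q := by
    rw [← map_mul, truncPoly_mk_eq_iff]
    intro i hi
    rw [PowerSeries.coeff_trunc, if_pos (Nat.lt_succ_iff.mpr hi), PowerSeries.coeff_mul,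
      Polynomial.coeff_mul]
    refine Finset.sum_congr rfl fun x hx ↦ ?_
    have := Finset.HasAntidiagonal.mem_antidiagonal.mp hx
    rw [PowerSeries.coeff_trunc, PowerSeries.coeff_trunc, if_pos (by omega), if_pos (by omega)]

lemma truncHom_eq_iff (m : ℕ) (p q : B⟦X⟧) :
    truncHom B m p = truncHom B m q ↔ ∀ i ≤ m, p.coeff i = q.coeff i := by
  refine (truncPoly_mk_eq_iff _ _ _).trans (forall₂_congr fun i hi ↦ ?_)
  rw [PowerSeries.coeff_trunc, PowerSeries.coeff_trunc, if_pos (by omega), if_pos (by omega)]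

lemma truncPolyProj_comp_truncHom (m : ℕ) :
    (truncPolyProj B m).comp (truncHom B (m + 1)) = truncHom B m := by
  ext p
  refine (truncPoly_mk_eq_iff _ _ _).mpr fun i hi ↦ ?_
  rw [PowerSeries.coeff_trunc, PowerSeries.coeff_trunc, if_pos (by omega), if_pos (by omega)]

lemma exists_truncHom_eq (x : ∀ m, TruncPoly B m)
    (hx : ∀ m, truncPolyProj B m (x (m + 1)) = x m) : ∃ p : B⟦X⟧, ∀ m, truncHom B m p = x m := by
  choose q hq using fun m ↦ Ideal.Quotient.mk_surjective (x m)
  have key : ∀ m i, i ≤ m → (q (m + 1)).coeff i = (q m).coeff i := by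
    intro m
    rw [← truncPoly_mk_eq_iff m, hq m, ← hx m, ← hq (m + 1)]
    rfl
  have key2 : ∀ i n, (q (i + n)).coeff i = (q i).coeff i := by
    intro i n
    induction n with
    | zero => rfl
    | succ n ih => rw [← add_assoc, key _ _ (by omega), ih]
  refine ⟨PowerSeries.mk fun i ↦ (q i).coeff i, fun m ↦ ?_⟩
  rw [← hq m]
  refine (truncPoly_mk_eq_iff _ _ _).mpr fun i hi ↦ ?_
  rw [PowerSeries.coeff_trunc, if_pos (by omega), PowerSeries.coeff_mk]
  obtain ⟨n, rfl⟩ := Nat.exists_eq_add_of_le hi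
  exact (key2 i n).symm

lemma truncHom_jointly_injective (p q : B⟦X⟧) (h : ∀ m, truncHom B m p = truncHom B m q) :
    p = q :=
  PowerSeries.ext fun i ↦ (truncHom_eq_iff i p q).mp (h i) i le_rfl

lemma exists_hom_truncHom_eq (φ : ∀ m, A →+* TruncPoly B m)
    (hφ : ∀ m, (truncPolyProj B m).comp (φ (m + 1)) = φ m) :
    ∃ ψ : A →+* B⟦X⟧, ∀ m, (truncHom B m).comp ψ = φ m := by
  choose ψ hψ using fun a ↦ exists_truncHom_eq (fun m ↦ φ m a) fun m ↦ RingHom.congr_fun (hφ m) a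
  refine ⟨{ toFun := ψ, map_one' := ?_, map_zero' := ?_, map_add' := ?_, map_mul' := ?_ }, ?_⟩
  · exact truncHom_jointly_injective _ _ fun m ↦ by simp [hψ]
  · intro a b; exact truncHom_jointly_injective _ _ fun m ↦ by simp [hψ]
  · exact truncHom_jointly_injective _ _ fun m ↦ by simp [hψ]
  · intro a b; exact truncHom_jointly_injective _ _ fun m ↦ by simp [hψ]
  · intro m; ext a; exact hψ a m

/-- The map `B[t] / (t ^ (m + 1)) → C[t] / (t ^ (m + 1))` induced by a ring map `B → C`. -/
def truncPolyMap (f : B →+* C) (m : ℕ) : TruncPoly B m →+* TruncPoly C m :=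
  Ideal.quotientMap _ (Polynomial.mapRingHom f) <| by
    rw [Ideal.span_singleton_le_iff_mem, Ideal.mem_comap]
    simpa using Ideal.mem_span_singleton_self _

lemma truncPolyMap_comp_truncHom (f : B →+* C) (m : ℕ) :
    (truncPolyMap f m).comp (truncHom B m) = (truncHom C m).comp (PowerSeries.map f) := by
  ext p
  refine (truncPoly_mk_eq_iff _ _ _).mpr fun i hi ↦ ?_
  simp [PowerSeries.coeff_trunc]
  split_ifs <;> simp

/-- The relations defining the ring of higher derivations. -/
inductive HSRel (A : Type u) [CommRing A] : MvPolynomial (ℕ × A) ℤ → Prop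
  | one (n : ℕ) : HSRel A (MvPolynomial.X (n, 1) - MvPolynomial.C (if n = 0 then 1 else 0))
  | add (n : ℕ) (a b : A) : HSRel A (MvPolynomial.X (n, a + b) - (MvPolynomial.X (n, a) + MvPolynomial.X (n, b)))
  | mul (n : ℕ) (a b : A) : HSRel A (MvPolynomial.X (n, a * b) -
      ∑ p ∈ Finset.HasAntidiagonal.antidiagonal n, MvPolynomial.X (p.1, a) * MvPolynomial.X (p.2, b))

/-- The ring of (Hasse–Schmidt) higher derivations of `A` over the integers. -/
abbrev HSRing (A : Type u) [CommRing A] : Type u :=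
  MvPolynomial (ℕ × A) ℤ ⧸ Ideal.span {p | HSRel A p}

lemma hs_mk_eq {p q : MvPolynomial (ℕ × A) ℤ} (h : HSRel A (p - q)) :
    (Ideal.Quotient.mk _ p : HSRing A) = Ideal.Quotient.mk _ q :=
  (Ideal.Quotient.mk_eq_mk_iff_sub_mem _ _).mpr (Ideal.subset_span h)

/-- The universal ring homomorphism `A → HS(A)⟦t⟧`. -/
def hsUniv (A : Type u) [CommRing A] : A →+* (HSRing A)⟦X⟧ :=
  RingHom.mk'
    { toFun := fun a ↦ PowerSeries.mk fun n ↦ Ideal.Quotient.mk _ (MvPolynomial.X (n, a))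
      map_one' := by
        ext n
        rw [PowerSeries.coeff_mk, hs_mk_eq (.one n), PowerSeries.coeff_one]
        split_ifs <;> simp
      map_mul' := fun a b ↦ by
        ext n
        rw [PowerSeries.coeff_mk, hs_mk_eq (.mul n a b), map_sum, PowerSeries.coeff_mul]
        simp }
    fun a b ↦ by
      ext n
      have := hs_mk_eq (.add n a b)
      simpa [PowerSeries.coeff_mk] using this

lemma coeff_hsUniv (a : A) (n : ℕ) :
    (hsUniv A a).coeff n = Ideal.Quotient.mk _ (MvPolynomial.X (n, a)) :=
  PowerSeries.coeff_mk n fun n ↦ Ideal.Quotient.mk _ (MvPolynomial.X (n, a))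

lemma hs_hom_ext (f g : HSRing A →+* B)
    (h : (PowerSeries.map f).comp (hsUniv A) = (PowerSeries.map g).comp (hsUniv A)) : f = g := by
  refine Ideal.Quotient.ringHom_ext (MvPolynomial.ringHom_ext (by simp) fun ⟨n, a⟩ ↦ ?_)
  have := congr(PowerSeries.coeff n ($h a))
  simpa [coeff_hsUniv] using this

lemma exists_hs_lift (φ : A →+* B⟦X⟧) :
    ∃ f : HSRing A →+* B, (PowerSeries.map f).comp (hsUniv A) = φ := by
  let g : MvPolynomial (ℕ × A) ℤ →+* B :=
    MvPolynomial.eval₂Hom (Int.castRingHom B) fun x ↦ (φ x.2).coeff x.1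
  refine ⟨Ideal.Quotient.lift _ g fun x hx ↦ ?_, ?_⟩
  · rw [← RingHom.mem_ker]
    refine Ideal.span_le.mpr ?_ hx
    rintro _ (n | ⟨n, a, b⟩ | ⟨n, a, b⟩)
    · split_ifs with h <;> simp [g, RingHom.mem_ker, PowerSeries.coeff_one, h]
    · simp [g, RingHom.mem_ker]
    · simp [g, RingHom.mem_ker, PowerSeries.coeff_mul, sub_eq_zero]
  · ext a n
    simp [coeff_hsUniv, g]

end Algebra

/-- The functor `T ↦ T × Spec ℤ[t] / (t ^ (m + 1))`. -/
def thickening (m : ℕ) : Scheme.{u} ⥤ Scheme.{u} :=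
  prod.functor.flip.obj (Spec (.of (TruncPoly (ULift.{u} ℤ) m)))

/-- The projection `T × Spec ℤ[t] / (t ^ (m + 1)) ⟶ T`. -/
def thickeningProj (m : ℕ) (T : Scheme.{u}) : (thickening m).obj T ⟶ T := prod.fst

/-- The closed immersion `T × Spec ℤ[t] / (t ^ (m + 1)) ⟶ T × Spec ℤ[t] / (t ^ (m + 2))`. -/
def thickeningInc (m : ℕ) : thickening.{u} m ⟶ thickening.{u} (m + 1) :=
  prod.functor.flip.map (Spec.map (CommRingCat.ofHom (truncPolyProj (ULift.{u} ℤ) m)))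

/- Representability of the functor of arcs without a base scheme: affine schemes first, then
gluing. This enters only the proof that the functor of arcs over a base is representable. -/
section Geometry

/-- The second projection. -/
def thickeningSnd (m : ℕ) (T : Scheme.{u}) :
    (thickening m).obj T ⟶ Spec (.of (TruncPoly (ULift.{u} ℤ) m)) := prod.snd

@[ext]
lemma thickening_hom_ext {m : ℕ} {W T : Scheme.{u}} {a b : W ⟶ (thickening m).obj T}
    (h₁ : a ≫ thickeningProj m T = b ≫ thickeningProj m T)
    (h₂ : a ≫ thickeningSnd m T = b ≫ thickeningSnd m T) : a = b :=
  Limits.prod.hom_ext h₁ h₂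

/-- Maps into the product. -/
def thickeningLift {m : ℕ} {W T : Scheme.{u}} (a : W ⟶ T)
    (b : W ⟶ Spec (.of (TruncPoly (ULift.{u} ℤ) m))) : W ⟶ (thickening m).obj T :=
  prod.lift a b

@[simp]
lemma thickeningLift_proj {m : ℕ} {W T : Scheme.{u}} (a : W ⟶ T)
    (b : W ⟶ Spec (.of (TruncPoly (ULift.{u} ℤ) m))) :
    thickeningLift a b ≫ thickeningProj m T = a :=
  prod.lift_fst _ _

@[simp]
lemma thickeningLift_proj_assoc {m : ℕ} {W T Z : Scheme.{u}} (a : W ⟶ T)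
    (b : W ⟶ Spec (.of (TruncPoly (ULift.{u} ℤ) m))) (h : T ⟶ Z) :
    thickeningLift a b ≫ thickeningProj m T ≫ h = a ≫ h := by
  rw [← Category.assoc, thickeningLift_proj]

@[simp]
lemma thickeningLift_snd {m : ℕ} {W T : Scheme.{u}} (a : W ⟶ T)
    (b : W ⟶ Spec (.of (TruncPoly (ULift.{u} ℤ) m))) :
    thickeningLift a b ≫ thickeningSnd m T = b :=
  prod.lift_snd _ _

@[simp]
lemma thickeningLift_snd_assoc {m : ℕ} {W T Z : Scheme.{u}} (a : W ⟶ T)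
    (b : W ⟶ Spec (.of (TruncPoly (ULift.{u} ℤ) m)))
    (h : Spec (.of (TruncPoly (ULift.{u} ℤ) m)) ⟶ Z) :
    thickeningLift a b ≫ thickeningSnd m T ≫ h = b ≫ h := by
  rw [← Category.assoc, thickeningLift_snd]

@[simp]
lemma thickening_map_proj (m : ℕ) {T T' : Scheme.{u}} (g : T ⟶ T') :
    (thickening m).map g ≫ thickeningProj m T' = thickeningProj m T ≫ g :=
  prod.map_fst _ _

@[simp]
lemma thickening_map_snd (m : ℕ) {T T' : Scheme.{u}} (g : T ⟶ T') :
    (thickening m).map g ≫ thickeningSnd m T' = thickeningSnd m T :=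
  (prod.map_snd _ _).trans (Category.comp_id _)

@[simp]
lemma thickeningInc_proj (m : ℕ) (T : Scheme.{u}) :
    (thickeningInc m).app T ≫ thickeningProj (m + 1) T = thickeningProj m T :=
  (prod.map_fst _ _).trans (Category.comp_id _)

@[simp]
lemma thickeningInc_snd (m : ℕ) (T : Scheme.{u}) :
    (thickeningInc m).app T ≫ thickeningSnd (m + 1) T = thickeningSnd m T ≫
      Spec.map (CommRingCat.ofHom (truncPolyProj (ULift.{u} ℤ) m)) :=
  prod.map_snd _ _

lemma isPullback_thickening_map (m : ℕ) {T T' : Scheme.{u}} (g : T ⟶ T') :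
    IsPullback ((thickening m).map g) (thickeningProj m T) (thickeningProj m T') g := by
  refine ⟨⟨by simp⟩, ⟨PullbackCone.IsLimit.mk _
    (fun s ↦ thickeningLift s.snd (s.fst ≫ thickeningSnd m T')) ?_ ?_ ?_⟩⟩
  · intro s
    ext1 <;> simp [s.condition]
  · intro s
    simp
  · intro s l h₁ h₂
    ext1
    · simp [h₂]
    · simp [← h₁]

instance (m : ℕ) {T T' : Scheme.{u}} (g : T ⟶ T') [IsOpenImmersion g] :
    IsOpenImmersion ((thickening m).map g) :=
  MorphismProperty.of_isPullback (isPullback_thickening_map m g).flip inferInstance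

/-- The map `B[t] / (t ^ (m + 1)) → B` that sends `t` to `0`. -/
def truncPolyZero (B : Type u) [CommRing B] (m : ℕ) : TruncPoly B m →+* B :=
  Ideal.Quotient.lift _ Polynomial.constantCoeff fun a ha ↦ by
    rw [Ideal.mem_span_singleton] at ha
    obtain ⟨c, rfl⟩ := ha
    simp

lemma truncPolyZero_comp_proj (B : Type u) [CommRing B] (m : ℕ) :
    (truncPolyZero B m).comp (truncPolyProj B m) = truncPolyZero B (m + 1) := by
  refine RingHom.ext fun x ↦ ?_
  obtain ⟨p, rfl⟩ := Ideal.Quotient.mk_surjective x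
  simp [truncPolyZero, truncPolyProj]

lemma comap_truncPolyZero_surjective (B : Type u) [CommRing B] (m : ℕ) :
    Function.Surjective (PrimeSpectrum.comap (truncPolyZero B m)) := by
  have hs : Function.Surjective (truncPolyZero B m) := fun b ↦
    ⟨Ideal.Quotient.mk _ (Polynomial.C b), by simp [truncPolyZero]⟩
  rw [← Set.range_eq_univ, range_comap_of_surjective _ _ hs, Set.eq_univ_iff_forall]
  intro x
  rw [PrimeSpectrum.mem_zeroLocus]
  intro a ha
  obtain ⟨p, rfl⟩ := Ideal.Quotient.mk_surjective a
  have hp : p.coeff 0 = 0 := by simpa [truncPolyZero, RingHom.mem_ker] using ha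
  obtain ⟨q, rfl⟩ := Polynomial.X_dvd_iff.mpr hp
  refine x.2.mem_of_pow_mem (m + 1) ?_
  have : (Ideal.Quotient.mk (Ideal.span {(Polynomial.X : B[X]) ^ (m + 1)})
    (Polynomial.X * q)) ^ (m + 1) = 0 := by
    rw [← map_pow, Ideal.Quotient.eq_zero_iff_mem, mul_pow, Ideal.mem_span_singleton]
    exact dvd_mul_right _ _
  rw [this]
  exact zero_mem _

lemma truncPolyZero_surjective_spec (m : ℕ) :
    Surjective (Spec.map (CommRingCat.ofHom (truncPolyZero (ULift.{u} ℤ) m))) :=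
  ⟨comap_truncPolyZero_surjective _ m⟩

/-- The zero section. -/
def zeroSection (m : ℕ) (T : Scheme.{u}) : T ⟶ (thickening m).obj T :=
  thickeningLift (𝟙 T) (specULiftZIsTerminal.from T ≫
    Spec.map (CommRingCat.ofHom (truncPolyZero (ULift.{u} ℤ) m)))

@[simp]
lemma zeroSection_proj (m : ℕ) (T : Scheme.{u}) :
    zeroSection m T ≫ thickeningProj m T = 𝟙 T := by simp [zeroSection]

lemma zeroSection_naturality (m : ℕ) {T T' : Scheme.{u}} (g : T ⟶ T') :
    zeroSection m T ≫ (thickening m).map g = g ≫ zeroSection m T' := by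
  ext1
  · simp [zeroSection]
  · simp only [zeroSection, Category.assoc, thickening_map_snd, thickeningLift_snd]
    rw [← Category.assoc]
    congr 1
    exact specULiftZIsTerminal.hom_ext _ _

lemma zeroSection_inc (m : ℕ) (T : Scheme.{u}) :
    zeroSection m T ≫ (thickeningInc m).app T = zeroSection (m + 1) T := by
  ext1
  · simp
  · simp only [zeroSection, Category.assoc, thickeningInc_snd, thickeningLift_snd,
      thickeningLift_snd_assoc]
    rw [← Spec.map_comp, ← CommRingCat.ofHom_comp, truncPolyZero_comp_proj]

lemma isPullback_zeroSection (m : ℕ) (T : Scheme.{u}) :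
    IsPullback (zeroSection m T) (specULiftZIsTerminal.from T) (thickeningSnd m T)
      (Spec.map (CommRingCat.ofHom (truncPolyZero (ULift.{u} ℤ) m))) := by
  refine ⟨⟨by simp [zeroSection]⟩, ⟨PullbackCone.IsLimit.mk _
    (fun s ↦ s.fst ≫ thickeningProj m T) ?_ ?_ ?_⟩⟩
  · intro s
    ext1
    · simp
    · simp only [zeroSection, Category.assoc, thickeningLift_snd]
      rw [s.condition, ← Category.assoc, ← Category.assoc]
      congr 1
      exact specULiftZIsTerminal.hom_ext _ _
  · intro s
    exact specULiftZIsTerminal.hom_ext _ _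
  · intro s l h₁ h₂
    simp [← h₁]

instance (m : ℕ) (T : Scheme.{u}) : Surjective (zeroSection m T) :=
  MorphismProperty.of_isPullback (isPullback_zeroSection m T).flip (truncPolyZero_surjective_spec m)

/-- The comparison `Spec (B[t] / (t ^ (m + 1))) ⟶ Spec B × Spec ℤ[t] / (t ^ (m + 1))`. -/
def specThickening (B : CommRingCat.{u}) (m : ℕ) :
    Spec (.of (TruncPoly B m)) ⟶ (thickening m).obj (Spec B) :=
  thickeningLift (Spec.map (CommRingCat.ofHom ((Ideal.Quotient.mk _).comp Polynomial.C)))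
    (Spec.map (CommRingCat.ofHom (truncPolyMap ((Int.castRingHom B).comp
      (ULift.ringEquiv.{0, u} (R := ℤ)).toRingHom) m)))

lemma isPushout_truncPoly (R B : Type u) [CommRing R] [CommRing B] (f : R →+* B) (m : ℕ) :
    IsPushout (CommRingCat.ofHom f)
      (CommRingCat.ofHom ((Ideal.Quotient.mk _).comp Polynomial.C : R →+* TruncPoly R m))
      (CommRingCat.ofHom ((Ideal.Quotient.mk _).comp Polynomial.C : B →+* TruncPoly B m))
      (CommRingCat.ofHom (truncPolyMap f m)) := by
  refine ⟨⟨?_⟩, ⟨PushoutCocone.IsColimit.mk _ (fun s ↦ CommRingCat.ofHom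
    (Ideal.Quotient.lift _ (Polynomial.eval₂RingHom s.inl.hom
      (s.inr.hom (Ideal.Quotient.mk _ Polynomial.X))) ?_)) ?_ ?_ ?_⟩⟩
  · ext x
    simp [truncPolyMap]
  · intro a ha
    rw [Ideal.mem_span_singleton] at ha
    obtain ⟨c, rfl⟩ := ha
    have : (Ideal.Quotient.mk (Ideal.span {(Polynomial.X : R[X]) ^ (m + 1)})
        Polynomial.X) ^ (m + 1) = 0 := by
      rw [← map_pow, Ideal.Quotient.eq_zero_iff_mem]
      exact Ideal.mem_span_singleton_self _
    rw [map_mul, map_pow]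
    simp only [Polynomial.coe_eval₂RingHom, Polynomial.eval₂_X]
    rw [← map_pow, this, map_zero, zero_mul]
  · intro s
    ext x
    simp
  · intro s
    ext1
    refine Ideal.Quotient.ringHom_ext (Polynomial.ringHom_ext (fun r ↦ ?_) ?_)
    · have := congr($(s.condition).hom r)
      simpa [truncPolyMap] using this
    · simp [truncPolyMap]
  · intro s l h₁ h₂
    ext1
    refine Ideal.Quotient.ringHom_ext (Polynomial.ringHom_ext (fun r ↦ ?_) ?_)
    · have := congr($(h₁).hom r)
      simpa using this
    · have := congr($(h₂).hom (Ideal.Quotient.mk _ Polynomial.X))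
      simpa [truncPolyMap] using this

instance (B : CommRingCat.{u}) (m : ℕ) : IsIso (specThickening B m) := by
  have h := isPullback_SpecMap_of_isPushout _ _ _ _ (isPushout_truncPoly (ULift.{u} ℤ) B
    ((Int.castRingHom B).comp (ULift.ringEquiv.{0, u} (R := ℤ)).toRingHom) m)
  have h' := isProductOfIsTerminalIsPullback _ _ _ _ specULiftZIsTerminal h.isLimit
  exact (h'.conePointUniqueUpToIso (prodIsProd _ _)).isIso_hom

lemma specThickening_naturality {B C : CommRingCat.{u}} (f : B ⟶ C) (m : ℕ) :
    Spec.map (CommRingCat.ofHom (truncPolyMap f.hom m)) ≫ specThickening B m =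
      specThickening C m ≫ (thickening m).map (Spec.map f) := by
  ext1
  · simp only [specThickening, Category.assoc, thickeningLift_proj, thickening_map_proj,
      thickeningLift_proj_assoc]
    rw [← Spec.map_comp, ← Spec.map_comp]
    congr 1
    ext x
    simp [truncPolyMap]
  · simp only [specThickening, Category.assoc, thickeningLift_snd, thickening_map_snd]
    rw [← Spec.map_comp]
    congr 1
    ext1
    refine Ideal.Quotient.ringHom_ext (Polynomial.ringHom_ext (fun r ↦ ?_) ?_)
    · simp [truncPolyMap]
    · simp [truncPolyMap]

lemma specThickening_inc (B : CommRingCat.{u}) (m : ℕ) :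
    Spec.map (CommRingCat.ofHom (truncPolyProj B m)) ≫ specThickening B (m + 1) =
      specThickening B m ≫ (thickeningInc m).app (Spec B) := by
  ext1
  · simp only [specThickening, Category.assoc, thickeningLift_proj, thickeningInc_proj]
    rw [← Spec.map_comp]
    congr 1
  · simp only [specThickening, Category.assoc, thickeningLift_snd, thickeningInc_snd,
      thickeningLift_snd_assoc]
    rw [← Spec.map_comp, ← Spec.map_comp]
    congr 1
    ext1
    refine Ideal.Quotient.ringHom_ext (Polynomial.ringHom_ext (fun r ↦ ?_) ?_)
    · simp [truncPolyMap, truncPolyProj]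
    · simp [truncPolyMap, truncPolyProj]


/-- Families of compatible maps `T × Spec ℤ[t] / (t ^ (m + 1)) ⟶ X`. -/
def AbsArc (X T : Scheme.{u}) : Type u :=
  { a : ∀ m, (thickening m).obj T ⟶ X // ∀ m, (thickeningInc m).app T ≫ a (m + 1) = a m }

@[ext]
lemma AbsArc.ext {X T : Scheme.{u}} {a b : AbsArc X T} (h : ∀ m, a.1 m = b.1 m) : a = b :=
  Subtype.ext (funext h)

/-- Restriction of arcs along a map of the parametrizing schemes. -/
def AbsArc.res {X T T' : Scheme.{u}} (a : AbsArc X T) (g : T' ⟶ T) : AbsArc X T' :=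
  ⟨fun m ↦ (thickening m).map g ≫ a.1 m, fun m ↦ by
    rw [← Category.assoc, ← (thickeningInc m).naturality, Category.assoc, a.2]⟩

/-- Composition of arcs with a map. -/
def AbsArc.comp {X Y T : Scheme.{u}} (a : AbsArc X T) (f : X ⟶ Y) : AbsArc Y T :=
  ⟨fun m ↦ a.1 m ≫ f, fun m ↦ by rw [← Category.assoc, a.2]⟩

@[simp]
lemma AbsArc.res_val {X T T' : Scheme.{u}} (a : AbsArc X T) (g : T' ⟶ T) (m : ℕ) :
    (a.res g).1 m = (thickening m).map g ≫ a.1 m := rfl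

@[simp]
lemma AbsArc.comp_val {X Y T : Scheme.{u}} (a : AbsArc X T) (f : X ⟶ Y) (m : ℕ) :
    (a.comp f).1 m = a.1 m ≫ f := rfl

/-- The functor of arcs without a base. -/
def absArcs (X : Scheme.{u}) : Scheme.{u}ᵒᵖ ⥤ Type u where
  obj T := AbsArc X T.unop
  map g := TypeCat.ofHom fun a ↦ a.res g.unop
  map_id T := by ext a : 3; ext1 m; simp
  map_comp f g := by ext a : 3; ext1 m; simp

lemma absArcs_map {X : Scheme.{u}} {T T' : Scheme.{u}} (g : T' ⟶ T) (a : AbsArc X T) :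
    (absArcs X).map g.op a = a.res g := rfl

/-- Functoriality of the functor of arcs. -/
def absArcsMap {X Y : Scheme.{u}} (f : X ⟶ Y) : absArcs X ⟶ absArcs Y where
  app T := TypeCat.ofHom fun a ↦ AbsArc.comp a f
  naturality T T' g := by ext a : 3; apply AbsArc.ext; intro m; exact Category.assoc _ _ _

lemma absArcsMap_app {X Y : Scheme.{u}} (f : X ⟶ Y) {T : Scheme.{u}} (a : AbsArc X T) :
    (absArcsMap f).app (op T) a = a.comp f := rfl

/-- The open cover of the thickening induced by an open cover. -/
def thickeningCover (m : ℕ) {T : Scheme.{u}} (𝓤 : T.OpenCover) :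
    ((thickening m).obj T).OpenCover :=
  Scheme.Cover.mkOfCovers 𝓤.I₀ (fun i ↦ (thickening m).obj (𝓤.X i))
    (fun i ↦ (thickening m).map (𝓤.f i)) (fun x ↦ by
      obtain ⟨i, y, hy⟩ := 𝓤.exists_eq (thickeningProj m T x)
      obtain ⟨z, hz, -⟩ := Scheme.exists_preimage_of_isPullback
        (isPullback_thickening_map m (𝓤.f i)) x y hy.symm
      exact ⟨i, z, hz⟩) (fun i ↦ inferInstance)

lemma absArc_hom_ext {X T : Scheme.{u}} (𝓤 : T.OpenCover) {a b : AbsArc X T}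
    (h : ∀ i, a.res (𝓤.f i) = b.res (𝓤.f i)) : a = b := by
  ext1 m
  refine (thickeningCover m 𝓤).hom_ext _ _ fun i ↦ ?_
  exact congr_fun (congr_arg Subtype.val (h i)) m

lemma absArcs_glue {X T : Scheme.{u}} (𝓤 : T.OpenCover) (x : ∀ i, AbsArc X (𝓤.X i))
    (hx : ∀ i j (W : Scheme.{u}) (g : W ⟶ 𝓤.X i) (g' : W ⟶ 𝓤.X j), g ≫ 𝓤.f i = g' ≫ 𝓤.f j →
      (x i).res g = (x j).res g') : ∃ a : AbsArc X T, ∀ i, a.res (𝓤.f i) = x i := by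
  have key : ∀ m i j, pullback.fst ((thickening m).map (𝓤.f i)) ((thickening m).map (𝓤.f j)) ≫
      (x i).1 m = pullback.snd _ _ ≫ (x j).1 m := by
    intro m i j
    let P := pullback ((thickening m).map (𝓤.f i)) ((thickening m).map (𝓤.f j))
    have hc : pullback.fst ((thickening m).map (𝓤.f i)) ((thickening m).map (𝓤.f j)) ≫
      (thickening m).map (𝓤.f i) = pullback.snd _ _ ≫ (thickening m).map (𝓤.f j) :=
      pullback.condition
    let h : P ⟶ (thickening m).obj P := thickeningLift (𝟙 P)
      (pullback.fst _ _ ≫ thickeningSnd m _)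
    have e := hx i j P (pullback.fst _ _ ≫ thickeningProj m _)
      (pullback.snd _ _ ≫ thickeningProj m _) (by
        simp only [Category.assoc, ← thickening_map_proj]
        rw [← Category.assoc, hc, Category.assoc])
    have e' := congr_fun (congr_arg Subtype.val e) m
    have e₁ : h ≫ (thickening m).map (pullback.fst _ _ ≫ thickeningProj m _) =
        pullback.fst _ _ := by
      ext1
      · rw [Category.assoc, thickening_map_proj, thickeningLift_proj_assoc, Category.id_comp]
      · simp [h]
    have e₂ : h ≫ (thickening m).map (pullback.snd _ _ ≫ thickeningProj m _) =
        pullback.snd _ _ := by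
      ext1
      · rw [Category.assoc, thickening_map_proj, thickeningLift_proj_assoc, Category.id_comp]
      · have := congr($hc ≫ thickeningSnd m T)
        simp only [Category.assoc, thickening_map_snd] at this
        simp [h, this]
    simp only [AbsArc.res_val] at e'
    rw [← e₁, ← e₂, Category.assoc, Category.assoc, e']
  let e m : (thickening m).obj T ⟶ X :=
    (thickeningCover m 𝓤).glueMorphisms (fun i ↦ (x i).1 m) (key m)
  have he m i : (thickening m).map (𝓤.f i) ≫ e m = (x i).1 m :=
    (thickeningCover m 𝓤).ι_glueMorphisms _ _ i
  have hc m (i : 𝓤.I₀) : (thickening m).map (𝓤.f i) ≫ (thickeningInc m).app T ≫ e (m + 1) =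
      (thickening m).map (𝓤.f i) ≫ e m := by
    rw [← Category.assoc, (thickeningInc m).naturality, Category.assoc, he, he, (x i).2]
  refine ⟨⟨e, fun m ↦ (thickeningCover m 𝓤).hom_ext _ _ fun i ↦ hc m i⟩, fun i ↦ ?_⟩
  · ext1 m
    exact he m i

lemma isSheaf_absArcs (X : Scheme.{u}) :
    Presieve.IsSheaf Scheme.zariskiTopology (absArcs X) := by
  rw [Precoverage.isSheaf_toGrothendieck_iff_of_isStableUnderBaseChange]
  rintro T S hS x hx
  obtain ⟨(𝓤 : T.OpenCover), rfl⟩ := Scheme.exists_cover_of_mem_pretopology hS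
  obtain ⟨a, ha⟩ := absArcs_glue 𝓤 (fun i ↦ x (𝓤.f i) (.mk i))
    (fun i j W g g' h ↦ hx _ _ (.mk i) (.mk j) h)
  refine ⟨a, ?_, ?_⟩
  · rintro Z e ⟨i⟩
    exact ha i
  · intro b hb
    refine absArc_hom_ext 𝓤 fun i ↦ ?_
    rw [ha i]
    exact hb _ (.mk i)

/-- The base map `T ⟶ X` of an arc. -/
def AbsArc.base {X T : Scheme.{u}} (a : AbsArc X T) : T ⟶ X := zeroSection 0 T ≫ a.1 0

lemma AbsArc.zeroSection_val {X T : Scheme.{u}} (a : AbsArc X T) (m : ℕ) :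
    zeroSection m T ≫ a.1 m = a.base := by
  induction m with
  | zero => rfl
  | succ m ih => rw [← ih, ← zeroSection_inc, Category.assoc, a.2]

lemma AbsArc.base_res {X T T' : Scheme.{u}} (a : AbsArc X T) (g : T' ⟶ T) :
    (a.res g).base = g ≫ a.base := by
  simp only [AbsArc.base, AbsArc.res_val]
  rw [← Category.assoc, zeroSection_naturality, Category.assoc]

lemma AbsArc.base_comp {X Y T : Scheme.{u}} (a : AbsArc X T) (f : X ⟶ Y) :
    (a.comp f).base = a.base ≫ f := (Category.assoc _ _ _).symm

lemma AbsArc.exists_lift {U X T : Scheme.{u}} (j : U ⟶ X) [IsOpenImmersion j] (a : AbsArc X T)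
    (h : Set.range a.base ⊆ Set.range j) : ∃ b : AbsArc U T, b.comp j = a := by
  have hr : ∀ m, Set.range (a.1 m) ⊆ Set.range j := by
    rintro m _ ⟨p, rfl⟩
    obtain ⟨q, rfl⟩ := (zeroSection m T).surjective p
    rw [← Scheme.Hom.comp_apply, a.zeroSection_val]
    exact h ⟨q, rfl⟩
  refine ⟨⟨fun m ↦ IsOpenImmersion.lift j (a.1 m) (hr m), fun m ↦ ?_⟩, ?_⟩
  · rw [← cancel_mono j, Category.assoc, IsOpenImmersion.lift_fac, IsOpenImmersion.lift_fac, a.2]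
  · ext1 m
    exact IsOpenImmersion.lift_fac _ _ _

lemma AbsArc.exists_lift_of_fac {U X T : Scheme.{u}} (j : U ⟶ X) [IsOpenImmersion j]
    (a : AbsArc X T) (q : T ⟶ U) (h : a.base = q ≫ j) : ∃ b : AbsArc U T, b.comp j = a :=
  AbsArc.exists_lift j a (by
    rw [h]
    rintro _ ⟨x, rfl⟩
    exact ⟨q x, (Scheme.Hom.comp_apply _ _ _).symm⟩)

lemma AbsArc.comp_injective {U X T : Scheme.{u}} (j : U ⟶ X) [Mono j] {a b : AbsArc U T}
    (h : a.comp j = b.comp j) : a = b := by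
  ext1 m
  have := congr_fun (congr_arg Subtype.val h) m
  exact (cancel_mono j).mp this

lemma isOpenImmersion_absArcsMap {U X : Scheme.{u}} (j : U ⟶ X) [IsOpenImmersion j] :
    IsOpenImmersion.presheaf (absArcsMap j) := by
  apply MorphismProperty.relative.of_exists
  intro T g
  let a : AbsArc X T := yonedaEquiv g
  obtain ⟨W, i, hi, hir⟩ : ∃ (W : Scheme.{u}) (i : W ⟶ T), IsOpenImmersion i ∧
      Set.range i = a.base ⁻¹' Set.range j :=
    ⟨_, (a.base ⁻¹ᵁ j.opensRange).ι, inferInstance, Scheme.Opens.range_ι _⟩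
  obtain ⟨b, hb⟩ := AbsArc.exists_lift j (a.res i) (by
    rw [AbsArc.base_res]
    rintro _ ⟨x, rfl⟩
    rw [Scheme.Hom.comp_apply]
    exact hir.le ⟨x, rfl⟩)
  have hb₂ {T' : Scheme.{u}} (h : T' ⟶ W) : (b.res h).comp j = a.res (h ≫ i) := by
    ext1 m
    have := congr_fun (congr_arg Subtype.val hb) m
    simp only [AbsArc.res_val, AbsArc.comp_val] at this ⊢
    rw [Category.assoc, this, Functor.map_comp, Category.assoc]
  refine ⟨W, (yonedaEquiv.symm b : _ ⟶ absArcs U), i, ?_, hi⟩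
  refine .of_forall_isPullback_app fun ⟨T'⟩ ↦ ?_
  rw [Types.isPullback_iff]
  have hg (h : T' ⟶ T) : g.app (op T') h = a.res h := (map_yonedaEquiv g h).symm
  refine ⟨?_, ?_, ?_⟩
  · refine ConcreteCategory.hom_ext _ _ fun (h : T' ⟶ W) ↦ ?_
    exact (hb₂ h).trans (hg (h ≫ i)).symm
  · rintro h h' ⟨-, e⟩
    exact (cancel_mono i).mp e
  · intro (c : AbsArc U T') (h : T' ⟶ T) e
    have e' : AbsArc.comp c j = a.res h := e.trans (hg h)
    have hr : Set.range h ⊆ Set.range i := by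
      rintro _ ⟨x, rfl⟩
      have : a.base (h x) = j (AbsArc.base c x) := by
        rw [← Scheme.Hom.comp_apply, ← Scheme.Hom.comp_apply, ← AbsArc.base_res, ← e',
          AbsArc.base_comp]
      rw [hir]
      exact ⟨_, this.symm⟩
    refine ⟨IsOpenImmersion.lift i h hr, ?_, IsOpenImmersion.lift_fac _ _ _⟩
    apply AbsArc.comp_injective j
    rw [e']
    exact (hb₂ _).trans (congr_arg (a.res ·) (IsOpenImmersion.lift_fac i h hr))

/-- The universal arc on `Spec A`, parametrized by the spectrum of the ring of higher
derivations. -/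
def univArc (A : CommRingCat.{u}) : AbsArc (Spec A) (Spec (.of (HSRing A))) :=
  ⟨fun m ↦ inv (specThickening (.of (HSRing A)) m) ≫
    Spec.map (CommRingCat.ofHom ((truncHom (HSRing A) m).comp (hsUniv A))), fun m ↦ by
      rw [← cancel_epi (specThickening (.of (HSRing A)) m), IsIso.hom_inv_id_assoc,
        ← Category.assoc, ← specThickening_inc, Category.assoc, IsIso.hom_inv_id_assoc,
        ← Spec.map_comp, ← CommRingCat.ofHom_comp, ← RingHom.comp_assoc,
        truncPolyProj_comp_truncHom]⟩

lemma specThickening_univArc (A : CommRingCat.{u}) (m : ℕ) :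
    specThickening (.of (HSRing A)) m ≫ (univArc A).1 m =
      Spec.map (CommRingCat.ofHom ((truncHom (HSRing A) m).comp (hsUniv A))) :=
  IsIso.hom_inv_id_assoc _ _

lemma specThickening_univArc_res (A B : CommRingCat.{u}) (f : HSRing A →+* B) (m : ℕ) :
    specThickening B m ≫ ((univArc A).res (Spec.map (CommRingCat.ofHom f))).1 m =
      Spec.map (CommRingCat.ofHom ((truncHom B m).comp ((PowerSeries.map f).comp (hsUniv A)))) := by
  rw [AbsArc.res_val, ← Category.assoc, ← specThickening_naturality, Category.assoc,
    specThickening_univArc, ← Spec.map_comp, ← CommRingCat.ofHom_comp, ← RingHom.comp_assoc,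
    CommRingCat.hom_ofHom, truncPolyMap_comp_truncHom, RingHom.comp_assoc]

lemma univArc_injective (A B : CommRingCat.{u}) (g g' : Spec B ⟶ Spec (.of (HSRing A)))
    (h : (univArc A).res g = (univArc A).res g') : g = g' := by
  obtain ⟨f, rfl⟩ := Spec.map_surjective g
  obtain ⟨f', rfl⟩ := Spec.map_surjective g'
  congr 1
  ext1
  refine hs_hom_ext _ _ (RingHom.ext fun a ↦ truncHom_jointly_injective _ _ fun m ↦ ?_)
  have := congr(specThickening B m ≫ ($h).1 m)
  have := ((specThickening_univArc_res A B f.hom m).symm.trans this).trans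
    (specThickening_univArc_res A B f'.hom m)
  exact congr($(Spec.map_injective this).hom a)

lemma univArc_surjective (A B : CommRingCat.{u}) (a : AbsArc (Spec A) (Spec B)) :
    ∃ g : Spec B ⟶ Spec (.of (HSRing A)), (univArc A).res g = a := by
  choose φ hφ using fun m ↦ Spec.map_surjective (specThickening B m ≫ a.1 m)
  obtain ⟨ψ, hψ⟩ := exists_hom_truncHom_eq (fun m ↦ (φ m).hom) (fun m ↦ by
    have : φ (m + 1) ≫ CommRingCat.ofHom (truncPolyProj B m) = φ m := by
      apply Spec.map_injective
      rw [Spec.map_comp, hφ, hφ, ← Category.assoc, specThickening_inc, Category.assoc, a.2]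
    exact congr($(this).hom))
  obtain ⟨f, hf⟩ := exists_hs_lift ψ
  refine ⟨Spec.map (CommRingCat.ofHom f), ?_⟩
  ext1 m
  rw [← cancel_epi (specThickening B m), specThickening_univArc_res, hf, hψ, ← hφ]
  rfl

/-- The universal arc as a map of presheaves. -/
def univArcMap (A : CommRingCat.{u}) : yoneda.obj (Spec (.of (HSRing A))) ⟶ absArcs (Spec A) :=
  yonedaEquiv.symm (univArc A)

/-- The sheaf of arcs. -/
def absArcsSheaf (X : Scheme.{u}) : Sheaf Scheme.zariskiTopology.{u} (Type u) :=
  ⟨absArcs X, (isSheaf_iff_isSheaf_of_type _ _).mpr (isSheaf_absArcs X)⟩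

lemma univArcMap_app (A : CommRingCat.{u}) (T : Scheme.{u}) (g : T ⟶ Spec (.of (HSRing A))) :
    (univArcMap A).app (op T) g = (univArc A).res g := rfl

lemma AbsArc.res_res {X T T' T'' : Scheme.{u}} (a : AbsArc X T) (g : T' ⟶ T) (h : T'' ⟶ T') :
    (a.res g).res h = a.res (h ≫ g) := by
  ext1 m
  simp

lemma univArc_injective' (A : CommRingCat.{u}) {T : Scheme.{u}}
    (g g' : T ⟶ Spec (.of (HSRing A))) (h : (univArc A).res g = (univArc A).res g') : g = g' := by
  refine T.affineOpenCover.openCover.hom_ext _ _ fun i ↦ univArc_injective A _ _ _ ?_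
  exact ((AbsArc.res_res _ _ _).symm.trans (congr_arg (AbsArc.res · _) h)).trans
    (AbsArc.res_res _ _ _)

lemma univArc_surjective' (A : CommRingCat.{u}) {T : Scheme.{u}} (a : AbsArc (Spec A) T) :
    ∃ g : T ⟶ Spec (.of (HSRing A)), (univArc A).res g = a := by
  let 𝓤 := T.affineOpenCover.openCover
  have (i : 𝓤.I₀) : ∃ g : 𝓤.X i ⟶ Spec (.of (HSRing A)), (univArc A).res g = a.res (𝓤.f i) :=
    univArc_surjective A (T.affineOpenCover.X i) (a.res (𝓤.f i))
  choose g hg using this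
  refine ⟨𝓤.glueMorphisms g fun i j ↦ univArc_injective' A _ _ ?_, absArc_hom_ext 𝓤 fun i ↦ ?_⟩
  · rw [← AbsArc.res_res, ← AbsArc.res_res, hg, hg, AbsArc.res_res, AbsArc.res_res,
      pullback.condition]
  · rw [AbsArc.res_res, 𝓤.ι_glueMorphisms, hg]

instance (A : CommRingCat.{u}) : IsIso (univArcMap A) := by
  rw [NatTrans.isIso_iff_isIso_app]
  intro T
  rw [isIso_iff_bijective]
  exact ⟨fun g g' h ↦ univArc_injective' A g g' h, fun a ↦ univArc_surjective' A a⟩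

theorem isRepresentable_absArcs (X : Scheme.{u}) : (absArcs X).IsRepresentable := by
  let 𝓤 := X.affineOpenCover
  let F : Sheaf Scheme.zariskiTopology.{u} (Type u) :=
    ⟨absArcs X, (isSheaf_iff_isSheaf_of_type _ _).mpr (isSheaf_absArcs X)⟩
  let f (i : 𝓤.I₀) : yoneda.obj (Spec (.of (HSRing (𝓤.X i)))) ⟶ F.1 :=
    univArcMap (𝓤.X i) ≫ absArcsMap (𝓤.f i)
  have hf (i : 𝓤.I₀) : IsOpenImmersion.presheaf (f i) :=
    (MorphismProperty.cancel_left_of_respectsIso IsOpenImmersion.presheaf _ _).mpr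
      (isOpenImmersion_absArcsMap (𝓤.f i))
  have : Presheaf.IsLocallySurjective Scheme.zariskiTopology (Sigma.desc f) := by
    refine ⟨fun {T} a ↦ ?_⟩
    let a' : AbsArc X T := a
    let 𝒱 := 𝓤.openCover.pullback₁ a'.base
    refine GrothendieckTopology.superset_covering _ ?_ (Scheme.Cover.mem_grothendieckTopology 𝒱)
    rintro W _ ⟨_, g, _, ⟨i⟩, rfl⟩
    have : IsOpenImmersion (𝓤.f i) := 𝓤.map_prop i
    obtain ⟨b, hb⟩ := AbsArc.exists_lift_of_fac (𝓤.f i) (a'.res (g ≫ 𝒱.f i))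
      (g ≫ pullback.snd _ _) (by
        rw [AbsArc.base_res]
        refine (Category.assoc _ _ _).trans (Eq.trans ?_ (Category.assoc _ _ _).symm)
        exact congr_arg (g ≫ ·) pullback.condition)
    obtain ⟨c, hc⟩ := univArc_surjective' _ b
    refine ⟨(Sigma.ι (fun i ↦ yoneda.obj (Spec (.of (HSRing (𝓤.X i))))) i).app (op W) c, ?_⟩
    have h₁ := ConcreteCategory.congr_hom
      (NatTrans.congr_app (Sigma.ι_desc f i) (op W)) c
    refine Eq.trans h₁ ?_
    refine (congr_arg (fun b ↦ AbsArc.comp b (𝓤.f i)) hc).trans hb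
  exact Scheme.LocalRepresentability.isRepresentable (F := F) hf

end Geometry

section Relative

variable {S : Scheme.{u}}

/-- An arc on the `S`-scheme `X` parametrized by the `S`-scheme `T`, as an element of the inverse
limit over `m` of the sets of jets, i.e. of `S`-morphisms `T × Spec ℤ[t] / (t ^ (m + 1)) ⟶ X`.
For `S = Spec k` and `T = Spec B` these are the `k`-morphisms `Spec B[t] / (t ^ (m + 1)) ⟶ X`. -/
@[ext]
structure Arc (X T : Over S) : Type u where
  /-- The `m`-jet of the arc. -/
  jet (m : ℕ) : (thickening m).obj T.left ⟶ X.left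
  inc_jet (m : ℕ) : (thickeningInc m).app T.left ≫ jet (m + 1) = jet m
  jet_hom (m : ℕ) : jet m ≫ X.hom = thickeningProj m T.left ≫ T.hom

/-- The pullback of an arc along a morphism of the parametrizing schemes. -/
def Arc.res {X T T' : Over S} (a : Arc X T) (g : T' ⟶ T) : Arc X T' where
  jet m := (thickening m).map g.left ≫ a.jet m
  inc_jet m := by
    rw [← Category.assoc, ← (thickeningInc m).naturality, Category.assoc, a.inc_jet]
  jet_hom m := by
    rw [Category.assoc, a.jet_hom, ← Category.assoc, thickening_map_proj, Category.assoc, Over.w]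

/-- The composition of an arc with a morphism of schemes over `S`. -/
def Arc.comp {X Y T : Over S} (a : Arc X T) (f : X ⟶ Y) : Arc Y T where
  jet m := a.jet m ≫ f.left
  inc_jet m := by rw [← Category.assoc, a.inc_jet]
  jet_hom m := by rw [Category.assoc, Over.w, a.jet_hom]

/-- The functor of points of the arc space, `T ↦ lim_m Hom_S (T × Spec ℤ[t] / (t ^ (m + 1)), X)`. -/
def arcFunctor (X : Over S) : (Over S)ᵒᵖ ⥤ Type u where
  obj T := Arc X T.unop
  map g := TypeCat.ofHom fun a ↦ a.res g.unop
  map_id T := ConcreteCategory.hom_ext _ _ fun (a : Arc X T.unop) ↦ Arc.ext <| funext fun m ↦ by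
    change (thickening m).map (𝟙 _) ≫ a.jet m = a.jet m
    simp
  map_comp {T T' T''} f g := ConcreteCategory.hom_ext _ _ fun (a : Arc X T.unop) ↦
    Arc.ext <| funext fun m ↦ by
      change (thickening m).map (g.unop.left ≫ f.unop.left) ≫ a.jet m =
        (thickening m).map g.unop.left ≫ (thickening m).map f.unop.left ≫ a.jet m
      simp

instance isRepresentable_arcFunctor (X : Over S) : (arcFunctor X).IsRepresentable := by
  obtain ⟨P, ⟨eP⟩⟩ := isRepresentable_absArcs X.left
  obtain ⟨Q, ⟨eQ⟩⟩ := isRepresentable_absArcs S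
  let eP' {T : Scheme.{u}} : (T ⟶ P) ≃ AbsArc X.left T := eP.homEquiv
  let eQ' {T : Scheme.{u}} : (T ⟶ Q) ≃ AbsArc S T := eQ.homEquiv
  have hP {T T' : Scheme.{u}} (g : T' ⟶ T) (h : T ⟶ P) : eP' (g ≫ h) = (eP' h).res g :=
    eP.homEquiv_comp g h
  have hQ {T T' : Scheme.{u}} (g : T' ⟶ T) (h : T ⟶ Q) : eQ' (g ≫ h) = (eQ' h).res g :=
    eQ.homEquiv_comp g h
  let c : AbsArc S S := ⟨fun m ↦ thickeningProj m S, fun m ↦ thickeningInc_proj m S⟩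
  let π : P ⟶ Q := eQ'.symm ((eP' (𝟙 P)).comp X.hom)
  let κ : S ⟶ Q := eQ'.symm c
  have hπ {T : Scheme.{u}} (g : T ⟶ P) : eQ' (g ≫ π) = (eP' g).comp X.hom := by
    rw [hQ, Equiv.apply_symm_apply]
    conv_rhs => rw [← Category.comp_id g, hP]
    ext1 m
    exact (Category.assoc _ _ _).symm
  have hκ {T : Scheme.{u}} (g : T ⟶ S) (m : ℕ) : (eQ' (g ≫ κ)).1 m = thickeningProj m T ≫ g := by
    rw [hQ, Equiv.apply_symm_apply]
    exact thickening_map_proj m g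
  have hcomm {T : Scheme.{u}} (g : T ⟶ P) (h : T ⟶ S) :
      g ≫ π = h ≫ κ ↔ ∀ m, (eP' g).1 m ≫ X.hom = thickeningProj m T ≫ h := by
    rw [← eQ'.injective.eq_iff, hπ, AbsArc.ext_iff]
    simp only [hκ, AbsArc.comp_val]
  let toArc {T : Over S} (g : T ⟶ Over.mk (pullback.snd π κ)) : Arc X T :=
    ⟨(eP' (g.left ≫ pullback.fst π κ)).1, (eP' (g.left ≫ pullback.fst π κ)).2, (hcomm _ _).mp (by
      rw [Category.assoc, pullback.condition, ← Category.assoc]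
      exact congr_arg (· ≫ κ) (Over.w g))⟩
  let abs {T : Over S} (a : Arc X T) : AbsArc X.left T.left := ⟨a.jet, a.inc_jet⟩
  let ofArc {T : Over S} (a : Arc X T) : T ⟶ Over.mk (pullback.snd π κ) :=
    Over.homMk (pullback.lift (eP'.symm (abs a)) T.hom ((hcomm _ _).mpr fun m ↦ by
      rw [Equiv.apply_symm_apply]
      exact a.jet_hom m)) (pullback.lift_snd _ _ _)
  refine ⟨Over.mk (pullback.snd π κ), ⟨⟨fun {T} ↦ ⟨toArc, ofArc, fun g ↦ ?_, fun a ↦ ?_⟩, ?_⟩⟩⟩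
  · ext1
    refine pullback.hom_ext ((pullback.lift_fst _ _ _).trans ?_)
      ((pullback.lift_snd _ _ _).trans (Over.w g).symm)
    exact eP'.symm_apply_apply _
  · refine Arc.ext ?_
    exact congr_arg Subtype.val ((congr_arg eP' (pullback.lift_fst _ _ _)).trans
      (eP'.apply_symm_apply (abs a)))
  · intro T T' g h
    refine Arc.ext ?_
    have := hP g.left (h.left ≫ pullback.fst π κ)
    rw [← Category.assoc] at this
    exact congr_arg Subtype.val this

/-- The arc space of a scheme `X` over `S`: the `S`-scheme that represents the functor of arcs. -/
def arcSpace (X : Over S) : Over S := (arcFunctor X).reprX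

/-- The universal property: `S`-morphisms `T ⟶ X_∞` are arcs on `X` parametrized by `T`. -/
def arcSpaceEquiv {X T : Over S} : (T ⟶ arcSpace X) ≃ Arc X T :=
  (arcFunctor X).representableBy.homEquiv

lemma arcSpaceEquiv_comp {X T T' : Over S} (g : T' ⟶ T) (h : T ⟶ arcSpace X) :
    arcSpaceEquiv (g ≫ h) = (arcSpaceEquiv h).res g :=
  (arcFunctor X).representableBy.homEquiv_comp g h

/-- The morphism of arc spaces induced by a morphism `f` of schemes over `S`: it corresponds to
the composition of the universal arc on `X` with `f`. -/
def arcSpaceMap {X Y : Over S} (f : X ⟶ Y) : arcSpace X ⟶ arcSpace Y :=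
  arcSpaceEquiv.symm ((arcSpaceEquiv (𝟙 (arcSpace X))).comp f)

/-- On `T`-valued points, the induced map of arc spaces is composition with `f`. -/
lemma arcSpaceEquiv_comp_arcSpaceMap {X Y T : Over S} (f : X ⟶ Y) (g : T ⟶ arcSpace X) :
    arcSpaceEquiv (g ≫ arcSpaceMap f) = (arcSpaceEquiv g).comp f := by
  rw [arcSpaceEquiv_comp, arcSpaceMap, Equiv.apply_symm_apply]
  conv_rhs => rw [← Category.comp_id g, arcSpaceEquiv_comp]
  exact Arc.ext <| funext fun m ↦ (Category.assoc _ _ _).symm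

end Relative

/-- The ramification locus of `f : X ⟶ Y`, i.e. the support of the sheaf of relative differentials,
whose stalk at `x` is the module of Kähler differentials of `𝒪_{X, x}` over `𝒪_{Y, f x}`. -/
def ramificationLocus {X Y : Scheme.{u}} (f : X ⟶ Y) : Set X :=
  { x | letI := (f.stalkMap x).hom.toAlgebra
        Nontrivial Ω[X.presheaf.stalk x⁄Y.presheaf.stalk (f x)] }

/-- A scheme is topologically finite if its underlying topological space is finite and discrete. -/
def IsTopologicallyFinite (X : Scheme.{u}) : Prop :=
  Finite X ∧ DiscreteTopology X

end ArcScheme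

end

open ArcScheme

/-!
The proof counts and compares points of the arc space `X_∞` with values in fields and in local rings.

Number of points. A point of `X_∞` over a field `Ω` is an arc `Spec Ω⟦t⟧ → X`, given in an affine
chart `Spec A → Spec C₀` of the quasi-finite morphism by a homomorphism from `A` to the domain `Ω⟦t⟧`
whose restriction to `C₀` is known. By Zariski's main theorem, `A` is covered by localizations that
are generated by integral elements up to denominators, so that these homomorphisms are determined by
roots of fixed monic polynomials: there are at most `d` of them, with `d` independent of `Ω`
(`exists_ncard_ringHom_le_of_quasiFinite`, `exists_ncard_arcSpace_lift_le`). Hence the residue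
fields of a fiber over a point with residue field `L` are algebraic over `L`, because transcendental
extensions have infinitely many embeddings into their algebraic closures. So each point of the fiber
comes from a point over the algebraic closure of `L`, which bounds their number by `d`, and the primes
of affine charts of the fiber are maximal (`isTopologicallyFinite_of_ncard_lift_le`).

Unramified part. The main point is that fibers outside of `R_∞` have no nilpotents. Let `C` be a local
ring over a field `K` and let two arcs `φ₁, φ₂ : A → C⟦t⟧` agree on `C₀` and modulo the maximal ideal
of `C`, with `φ₂` defined over `K` and not contained in the ramification locus. Some `e ∈ A`
annihilates the differentials of `A` over `C₀` and has `φ₂ e = t ^ N * unit`. Modulo the square of the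
ideal `𝔓` generated by all `φ₁ a - φ₂ a`, this difference is a derivation, so `t ^ N 𝔓 ⊆ 𝔓²`. By
Cayley–Hamilton, `(t ^ M - y) 𝔓 = 0` for some `M` and some `y ∈ 𝔓`; thus `y² = t ^ M y`, and
Nakayama's lemma applied to the first `M` coefficients of `y` yields `y = 0`. Since `t` is a nonzerodivisor,
`𝔓 = 0` and `φ₁ = φ₂` (`ext_of_kaehlerDifferential`, `arcSpace_hom_ext_of_isLocalRing`). Applied to
the local rings of the fiber over the algebraic closure of `L`, this says that they are equal to that
field; being finite in number, they show that the fiber is finite and reduced, by descent from the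
algebraic closure (`finite_and_isReduced_of_finite_algHom`).

The image of `R_∞` is closed because `R_∞` is cut out in `X_∞` by the coefficients of the universal arc
at the equations of `R` (`isClosed_range_arcSpaceMap`).
-/

universe v
open scoped TensorProduct
noncomputable section
namespace ArcScheme

/-! ### Rigidity of ring homomorphisms into power series -/

lemma isLeftRegular_X_pow (C : Type*) [CommRing C] (M : ℕ) :
    IsLeftRegular ((PowerSeries.X : C⟦X⟧) ^ M) := by
  intro a b hab
  ext n
  simpa [PowerSeries.coeff_X_pow_mul'] using congr(PowerSeries.coeff (n + M) $hab)

/-- A Nakayama argument: comparing the coefficients of `X ^ (M + n)` for `n < M` shows that the ideal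
generated by the first `M` coefficients of `y` is contained in its product with the maximal ideal.
So `X ^ M` divides `y`, say `y = X ^ M * z`, and then `z * (1 - z) = 0` with `1 - z` a unit. No
finiteness or separatedness of the local ring `C` is needed. -/
lemma powerSeries_eq_zero_of_sq_eq_X_pow_mul {C : Type*} [CommRing C] [IsLocalRing C] {y : C⟦X⟧}
    (hm : ∀ n, y.coeff n ∈ IsLocalRing.maximalIdeal C) {M : ℕ}
    (hy : y ^ 2 = PowerSeries.X ^ M * y) : y = 0 := by
  set m := IsLocalRing.maximalIdeal C
  let 𝔞 : Ideal C := Ideal.span (Set.range fun i : Fin M ↦ y.coeff i)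
  have hmem (i : ℕ) (hi : i < M) : y.coeff i ∈ 𝔞 := Ideal.subset_span ⟨⟨i, hi⟩, rfl⟩
  have hle : 𝔞 ≤ m • 𝔞 := by
    refine Ideal.span_le.mpr ?_
    rintro _ ⟨⟨n, hn⟩, rfl⟩
    have h := congr(PowerSeries.coeff (M + n) $hy)
    rw [PowerSeries.coeff_X_pow_mul', if_pos (Nat.le_add_right _ _), Nat.add_sub_cancel_left, sq,
      PowerSeries.coeff_mul] at h
    simp only [SetLike.mem_coe]
    rw [← h]
    refine Ideal.sum_mem _ fun p hp ↦ ?_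
    have hp' := Finset.HasAntidiagonal.mem_antidiagonal.mp hp
    by_cases h1 : p.1 < M
    · rw [mul_comm]
      exact Ideal.mul_mem_mul (hm _) (hmem _ h1)
    · exact Ideal.mul_mem_mul (hm _) (hmem _ (by omega))
  have h0 : 𝔞 = ⊥ := Submodule.eq_bot_of_le_smul_of_le_jacobson_bot m 𝔞
    (Submodule.fg_span (Set.finite_range _)) hle (IsLocalRing.maximalIdeal_le_jacobson _)
  obtain ⟨z, rfl⟩ : PowerSeries.X ^ M ∣ y := by
    rw [PowerSeries.X_pow_dvd_iff]
    intro i hi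
    simpa [h0] using hmem i hi
  have hz : z * (1 - z) = 0 := by
    apply isLeftRegular_X_pow C M
    apply isLeftRegular_X_pow C M
    simp only
    linear_combination -hy
  have hu : IsUnit (1 - z) := by
    rw [PowerSeries.isUnit_iff_constantCoeff]
    have := hm M
    rw [PowerSeries.coeff_X_pow_mul', if_pos le_rfl, Nat.sub_self] at this
    simpa using IsLocalRing.isUnit_one_sub_self_of_mem_nonunits _ this
  rw [hu.mul_left_eq_zero.mp hz, mul_zero]

/-- Two extensions to `A` of a homomorphism `C₀ → C⟦X⟧` that agree modulo the maximal ideal of `C`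
are equal if some `e` that annihilates the differentials of `A` over `C₀` is sent to a power of `X`
times a unit. The ideal `𝔓` generated by the differences satisfies `X ^ N • 𝔓 ≤ 𝔓 ^ 2`. -/
lemma ext_of_kaehlerDifferential {C₀ A C : Type*} [CommRing C₀] [CommRing A]
    [CommRing C] [Algebra C₀ A] [Algebra.FiniteType C₀ A] [IsLocalRing C] (φ₁ φ₂ : A →+* C⟦X⟧)
    (h₀ : φ₁.comp (algebraMap C₀ A) = φ₂.comp (algebraMap C₀ A))
    (hm : ∀ a n, (φ₁ a - φ₂ a).coeff n ∈ IsLocalRing.maximalIdeal C)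
    (e : A) (he : ∀ ω : Ω[A⁄C₀], e • ω = 0) (N : ℕ) (v : C⟦X⟧) (hv : IsUnit v)
    (hev : φ₂ e = PowerSeries.X ^ N * v) : φ₁ = φ₂ := by
  let S := C⟦X⟧
  let 𝔓 : Ideal S := Ideal.span (Set.range fun a ↦ φ₁ a - φ₂ a)
  have hmem (a : A) : φ₁ a - φ₂ a ∈ 𝔓 := Ideal.subset_span ⟨a, rfl⟩
  have hfg : 𝔓.FG := by
    obtain ⟨s, hs⟩ := Algebra.FiniteType.out (R := C₀) (A := A)
    let 𝔮 : Ideal S := Ideal.span ((fun a ↦ φ₁ a - φ₂ a) '' s)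
    have : 𝔓 = 𝔮 := by
      refine le_antisymm (Ideal.span_le.mpr ?_) (Ideal.span_mono (Set.image_subset_range _ _))
      rintro _ ⟨a, rfl⟩
      have ha : a ∈ Algebra.adjoin C₀ (s : Set A) := hs ▸ trivial
      induction ha using Algebra.adjoin_induction with
      | mem x hx => exact Ideal.subset_span ⟨x, hx, rfl⟩
      | algebraMap r =>
        have := RingHom.congr_fun h₀ r
        simp only [RingHom.comp_apply] at this
        simp [this]
      | add x y _ _ hx hy =>
        simp only [SetLike.mem_coe] at hx hy ⊢
        convert 𝔮.add_mem hx hy using 1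
        simp only [map_add]
        ring
      | mul x y _ _ hx hy =>
        simp only [SetLike.mem_coe] at hx hy ⊢
        convert 𝔮.add_mem (𝔮.mul_mem_left (φ₁ y) hx) (𝔮.mul_mem_left (φ₂ x) hy) using 1
        simp only [map_mul]
        ring
    rw [this]
    exact Submodule.fg_span (s.finite_toSet.image _)
  -- `a ↦ φ₁ a - φ₂ a` is a derivation with values in `𝔓 / 𝔓²`, so it is killed by `e`.
  have hsq (a : A) : φ₂ e * (φ₁ a - φ₂ a) ∈ 𝔓 ^ 2 := by
    let _ : Module A 𝔓.Cotangent := Module.compHom _ φ₂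
    let _ : Module C₀ 𝔓.Cotangent := Module.compHom _ (φ₂.comp (algebraMap C₀ A))
    have : IsScalarTower C₀ A 𝔓.Cotangent := ⟨fun r a x ↦ by
      change φ₂ (r • a) • x = φ₂ (algebraMap C₀ A r) • (φ₂ a • x)
      rw [Algebra.smul_def, map_mul, mul_smul]⟩
    have hsm (a : A) (x : 𝔓.Cotangent) : a • x = φ₂ a • x := rfl
    have hsm0 (a : C₀) (x : 𝔓.Cotangent) : a • x = φ₂ (algebraMap C₀ A a) • x := rfl
    let D : Derivation C₀ A 𝔓.Cotangent :=
      { toFun := fun a ↦ 𝔓.toCotangent ⟨φ₁ a - φ₂ a, hmem a⟩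
        map_add' := fun a b ↦ by
          rw [← map_add]
          congr 1
          ext1
          simp only [map_add, Submodule.coe_add]
          ring
        map_smul' := fun r a ↦ by
          rw [RingHom.id_apply, hsm0, ← map_smul]
          congr 1
          ext1
          have := RingHom.congr_fun h₀ r
          simp only [RingHom.comp_apply] at this
          simp [Algebra.smul_def, this, mul_sub]
        map_one_eq_zero' := by
          change 𝔓.toCotangent _ = 0
          rw [Ideal.toCotangent_eq_zero]
          simp
        leibniz' := fun a b ↦ by
          change 𝔓.toCotangent _ = φ₂ a • 𝔓.toCotangent _ + φ₂ b • 𝔓.toCotangent _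
          rw [← map_smul, ← map_smul, ← map_add, Ideal.toCotangent_eq]
          simp only [map_mul, Submodule.coe_add, Submodule.coe_smul, smul_eq_mul, sq]
          convert Ideal.mul_mem_mul (hmem a) (hmem b) using 1
          ring }
    have h1 : e • D.liftKaehlerDifferential (KaehlerDifferential.D C₀ A a) = 0 := by
      rw [← map_smul, he, map_zero]
    rw [Derivation.liftKaehlerDifferential_comp_D, hsm] at h1
    change φ₂ e • 𝔓.toCotangent _ = 0 at h1
    rw [← map_smul, Ideal.toCotangent_eq_zero] at h1
    exact h1
  have hX : ∀ y ∈ 𝔓, (PowerSeries.X ^ N : S) * y ∈ 𝔓 ^ 2 := by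
    obtain ⟨w, rfl⟩ := hv
    intro y hy
    induction hy using Submodule.span_induction with
    | mem x hx =>
      obtain ⟨a, rfl⟩ := hx
      convert (𝔓 ^ 2).mul_mem_left (↑w⁻¹ : S) (hsq a) using 1
      rw [hev, ← mul_assoc, mul_comm (PowerSeries.X ^ N) (w : S), w.inv_mul_cancel_left]
    | zero => simp
    | add x y _ _ hx hy => rw [mul_add]; exact add_mem hx hy
    | smul c x _ hx =>
      rw [smul_eq_mul, mul_left_comm]
      exact Ideal.mul_mem_left _ _ hx
  -- By Cayley–Hamilton, some `X ^ M - y` with `y ∈ 𝔓` annihilates `𝔓`.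
  obtain ⟨M, y, hy, hyM⟩ : ∃ (M : ℕ) (y : S), y ∈ 𝔓 ∧ ∀ x ∈ 𝔓, (PowerSeries.X ^ M - y) * x = 0 := by
    have : Module.Finite S 𝔓 := Module.Finite.iff_fg.mpr hfg
    let g : Module.End S 𝔓 := algebraMap S (Module.End S 𝔓) (PowerSeries.X ^ N)
    obtain ⟨p, hp, -, hpc, hp0⟩ :=
      LinearMap.exists_monic_and_natDegree_eq_and_coeff_mem_pow_and_aeval_eq_zero S g 𝔓 (by
        rintro _ ⟨x, rfl⟩
        rw [Submodule.mem_smul_top_iff, smul_eq_mul, ← sq]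
        exact hX x x.2)
    refine ⟨N * p.natDegree, PowerSeries.X ^ (N * p.natDegree) - p.eval (PowerSeries.X ^ N), ?_,
      fun x hx ↦ ?_⟩
    · nth_rw 2 [hp.as_sum]
      rw [pow_mul, Polynomial.eval_add, Polynomial.eval_pow, Polynomial.eval_X, sub_add_cancel_left,
        Polynomial.eval_finsetSum]
      refine neg_mem (Ideal.sum_mem _ fun k hk ↦ ?_)
      rw [Polynomial.eval_mul, Polynomial.eval_C]
      refine Ideal.mul_mem_right _ _ (Ideal.pow_le_self ?_ (hpc k))
      have := Finset.mem_range.mp hk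
      omega
    · rw [sub_sub_cancel]
      rw [Polynomial.aeval_algebraMap_apply_eq_algebraMap_eval] at hp0
      exact congr(($hp0 ⟨x, hx⟩ : S))
  have hy𝔓 : ∀ x ∈ 𝔓, ∀ n, PowerSeries.coeff n x ∈ IsLocalRing.maximalIdeal C := by
    intro x hx
    induction hx using Submodule.span_induction with
    | mem x hx =>
      obtain ⟨a, rfl⟩ := hx
      exact hm a
    | zero => simp
    | add x y _ _ hx hy => intro n; rw [map_add]; exact add_mem (hx n) (hy n)
    | smul c x _ hx =>
      intro n
      rw [smul_eq_mul, PowerSeries.coeff_mul]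
      exact Ideal.sum_mem _ fun p _ ↦ Ideal.mul_mem_left _ _ (hx _)
  have hy0 : y = 0 := powerSeries_eq_zero_of_sq_eq_X_pow_mul (hy𝔓 y hy) (M := M) (by
    linear_combination -(hyM y hy))
  ext a : 1
  refine sub_eq_zero.mp (isLeftRegular_X_pow C M ?_)
  simpa [hy0] using hyM _ (hmem a)

/-! ### Homomorphisms out of quasi-finite and out of finite algebras -/

/-- If each element of `A` becomes integral after multiplication with a power of `r`, a homomorphism
`φ` with `φ r ≠ 0` is determined by its values at finitely many integral elements, which are roots of fixed
monic polynomials; the degrees of these polynomials bound the number of all `φ`. -/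
lemma exists_ncard_ringHom_le_of_isIntegral_mul {C₀ A : Type*} [CommRing C₀] [CommRing A]
    [Algebra C₀ A] [Algebra.FiniteType C₀ A] (r : A)
    (hr : ∀ x : A, ∃ m : ℕ, IsIntegral C₀ (r ^ m * x)) :
    ∃ d : ℕ, ∀ (D : Type v) [CommRing D] [IsDomain D] (c : C₀ →+* D),
      {φ : A →+* D | φ.comp (algebraMap C₀ A) = c ∧ φ r ≠ 0}.Finite ∧
      {φ : A →+* D | φ.comp (algebraMap C₀ A) = c ∧ φ r ≠ 0}.ncard ≤ d := by
  classical
  obtain ⟨s, hs⟩ := Algebra.FiniteType.out (R := C₀) (A := A)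
  choose m hm using hr
  have hrr : IsIntegral C₀ r := by
    have h := hm r
    rw [← pow_succ] at h
    exact (IsIntegral.pow_iff (by simp)).mp h
  choose q hq hq0 using hm
  obtain ⟨p, hp, hp0⟩ := hrr
  refine ⟨p.natDegree * ∏ x : s, (q x).natDegree, fun D _ _ c ↦ ?_⟩
  let T : Finset (D × (s → D)) := (p.map c).roots.toFinset ×ˢ
    Fintype.piFinset fun x : s ↦ ((q x).map c).roots.toFinset
  have hcard : T.card ≤ p.natDegree * ∏ x : s, (q x).natDegree := by
    rw [Finset.card_product, Fintype.card_piFinset]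
    have h (g : C₀[X]) (hg : g.Monic) : (g.map c).roots.toFinset.card ≤ g.natDegree :=
      (Multiset.toFinset_card_le _).trans ((Polynomial.card_roots' _).trans
        (Polynomial.natDegree_map_le))
    exact Nat.mul_le_mul (h p hp) (Finset.prod_le_prod' fun x _ ↦ h _ (hq x))
  let ev : (A →+* D) → D × (s → D) := fun φ ↦ (φ r, fun x ↦ φ (r ^ m x * x))
  have hroot {φ : A →+* D} (hφ : φ.comp (algebraMap C₀ A) = c) {g : C₀[X]} (hg : g.Monic) {z : A}
      (hz : Polynomial.eval₂ (algebraMap C₀ A) z g = 0) : φ z ∈ (g.map c).roots.toFinset := by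
    rw [Multiset.mem_toFinset, Polynomial.mem_roots (hg.map c).ne_zero, Polynomial.IsRoot.def,
      Polynomial.eval_map, ← hφ, ← Polynomial.hom_eval₂, hz, map_zero]
  have hmaps : Set.MapsTo ev {φ : A →+* D | φ.comp (algebraMap C₀ A) = c ∧ φ r ≠ 0} T := by
    rintro φ ⟨hφ, -⟩
    simp only [T, Finset.coe_product, Set.mem_prod, Finset.mem_coe, Fintype.mem_piFinset, ev]
    exact ⟨hroot hφ hp hp0, fun x ↦ hroot hφ (hq x) (hq0 x)⟩
  have hinj : Set.InjOn ev {φ : A →+* D | φ.comp (algebraMap C₀ A) = c ∧ φ r ≠ 0} := by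
    rintro φ ⟨hφ, hφr⟩ φ' ⟨hφ', -⟩ h
    ext a
    have ha : a ∈ Algebra.adjoin C₀ (s : Set A) := hs ▸ trivial
    induction ha using Algebra.adjoin_induction with
    | mem x hx =>
      have h1 : φ r = φ' r := congr_arg Prod.fst h
      have h2 : φ (r ^ m x * x) = φ' (r ^ m x * x) := congr_fun (congr_arg Prod.snd h) ⟨x, hx⟩
      rw [map_mul, map_mul, map_pow, map_pow, ← h1] at h2
      exact mul_left_cancel₀ (pow_ne_zero _ hφr) h2
    | algebraMap x => exact RingHom.congr_fun (hφ.trans hφ'.symm) x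
    | add x y _ _ hx hy => rw [map_add, map_add, hx, hy]
    | mul x y _ _ hx hy => rw [map_mul, map_mul, hx, hy]
  refine ⟨Set.Finite.of_injOn hmaps hinj T.finite_toSet, ?_⟩
  refine (Set.ncard_le_ncard_of_injOn ev hmaps hinj T.finite_toSet).trans ?_
  rwa [Set.ncard_coe_finset]

/-- By Zariski's main theorem, the elements `r` as in `exists_ncard_ringHom_le_of_isIntegral_mul`
generate the unit ideal. The bound does not depend on the target. -/
theorem exists_ncard_ringHom_le_of_quasiFinite (C₀ A : Type*) [CommRing C₀] [CommRing A]
    [Algebra C₀ A] [Algebra.FiniteType C₀ A] [Algebra.QuasiFinite C₀ A] :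
    ∃ d : ℕ, ∀ (D : Type v) [CommRing D] [IsDomain D] (c : C₀ →+* D),
      {φ : A →+* D | φ.comp (algebraMap C₀ A) = c}.Finite ∧
      {φ : A →+* D | φ.comp (algebraMap C₀ A) = c}.ncard ≤ d := by
  classical
  let P : Set A := {r | ∀ x : A, ∃ m : ℕ, IsIntegral C₀ (r ^ m * x)}
  have hP : Ideal.span P = ⊤ := by
    by_contra h
    obtain ⟨M, hM, hPM⟩ := Ideal.exists_le_maximal _ h
    obtain ⟨r, hrM, hr⟩ := Algebra.zariskisMainProperty_iff'.mp
      (Algebra.ZariskisMainProperty.of_finiteType (R := C₀) M)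
    exact hrM (hPM (Ideal.subset_span hr))
  obtain ⟨t, htP, ht⟩ := (Ideal.span_eq_top_iff_finite _).mp hP
  choose d hd using fun r : t ↦
    exists_ncard_ringHom_le_of_isIntegral_mul.{v} (C₀ := C₀) r.1 (htP r.2)
  refine ⟨∑ r, d r, fun D _ _ c ↦ ?_⟩
  have hsub : {φ : A →+* D | φ.comp (algebraMap C₀ A) = c} =
      ⋃ r : t, {φ : A →+* D | φ.comp (algebraMap C₀ A) = c ∧ φ r ≠ 0} := by
    refine subset_antisymm (fun φ hφ ↦ ?_) (Set.iUnion_subset fun r φ hφ ↦ hφ.1)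
    by_contra h
    simp only [Set.mem_iUnion, Set.mem_ofPred_eq, not_exists, not_and, not_not] at h
    have : Ideal.span (t : Set A) ≤ RingHom.ker φ :=
      Ideal.span_le.mpr fun r hr ↦ h ⟨r, hr⟩ hφ
    rw [ht] at this
    exact RingHom.ker_ne_top φ (top_le_iff.mp this)
  rw [hsub]
  refine ⟨Set.finite_iUnion fun r ↦ (hd r D c).1, ?_⟩
  refine (Set.ncard_iUnion_le_of_fintype _).trans (Finset.sum_le_sum fun r _ ↦ (hd r D c).2)

/-- A transcendental extension of `L` has infinitely many embeddings into its algebraic closure. -/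
lemma isAlgebraic_of_finite_algHom (L κ : Type u) [Field L] [Field κ] [Algebra L κ]
    (h : ∀ (Ω : Type u) [Field Ω] [Algebra L Ω], Finite (κ →ₐ[L] Ω)) :
    Algebra.IsAlgebraic L κ := by
  by_contra hκ
  have : Algebra.Transcendental L κ := Algebra.transcendental_iff_not_isAlgebraic.mpr hκ
  exact (Field.infinite_emb_of_transcendental L κ).not_finite (h (AlgebraicClosure κ))

lemma residueField_algHom_injective {L R Ω : Type*} [Field L] [CommRing R] [Algebra L R] [Field Ω]
    [Algebra L Ω] (p : Ideal R) [p.IsPrime] :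
    Function.Injective fun g : p.ResidueField →ₐ[L] Ω ↦
      g.comp (IsScalarTower.toAlgHom L R p.ResidueField) := by
  intro g g' h
  have h' : g.toRingHom.comp (algebraMap R _) = g'.toRingHom.comp (algebraMap R _) :=
    RingHom.ext fun x ↦ AlgHom.congr_fun h x
  exact AlgHom.ext fun x ↦ RingHom.congr_fun (Ideal.ResidueField.ringHom_ext h') x

/-- A criterion for `R` to be finite and reduced over a field `L` without assuming it of finite type:
it has finitely many points over each field, and each of its points over a local algebra `C` over
the algebraic closure `K` of `L`, with residue field `K`, is constant. The first condition shows that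
`K ⊗ R` has finitely many primes with residue field `K`, the second that its local rings are `K`. -/
theorem finite_and_isReduced_of_finite_algHom (L R : Type u) [Field L] [CommRing R] [Algebra L R]
    (hfin : ∀ (Ω : Type u) [Field Ω] [Algebra L Ω], Finite (R →ₐ[L] Ω))
    (hrig : ∀ (C : Type u) [CommRing C] [IsLocalRing C] [Algebra L C]
      [Algebra (AlgebraicClosure L) C] [IsScalarTower L (AlgebraicClosure L) C],
      Function.Surjective (algebraMap (AlgebraicClosure L) (IsLocalRing.ResidueField C)) →
      ∀ (g : R →ₐ[L] C) (r : R), g r ∈ (algebraMap (AlgebraicClosure L) C).range) :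
    Module.Finite L R ∧ IsReduced R := by
  let K := AlgebraicClosure L
  let R' := K ⊗[L] R
  have hfin' (Ω : Type u) [Field Ω] [Algebra K Ω] : Finite (R' →ₐ[K] Ω) := by
    let : Algebra L Ω := ((algebraMap K Ω).comp (algebraMap L K)).toAlgebra
    have : IsScalarTower L K Ω := .of_algebraMap_eq' rfl
    have := hfin Ω
    refine Finite.of_injective (fun g : R' →ₐ[K] Ω ↦ (g.restrictScalars L).comp
      Algebra.TensorProduct.includeRight) fun g g' h ↦ ?_
    exact Algebra.TensorProduct.ext_ring h
  have halg (q : Ideal R') [q.IsPrime] : Algebra.IsAlgebraic K q.ResidueField :=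
    isAlgebraic_of_finite_algHom K _ fun Ω _ _ ↦
      have := hfin' Ω
      Finite.of_injective _ (residueField_algHom_injective q)
  -- `K` is algebraically closed, so that it is the residue field at each prime.
  have hbij (q : Ideal R') [q.IsPrime] : Function.Bijective (algebraMap K q.ResidueField) :=
    IsAlgClosed.algebraMap_bijective_of_isIntegral
  have hprimes : Finite (PrimeSpectrum R') := by
    have := hfin' K
    let ev (q : PrimeSpectrum R') : R' →ₐ[K] K :=
      (AlgEquiv.ofBijective (Algebra.ofId K q.asIdeal.ResidueField) (hbij q.asIdeal)).symm.toAlgHom.comp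
        (IsScalarTower.toAlgHom K R' q.asIdeal.ResidueField)
    refine Finite.of_injective ev fun q q' h ↦ PrimeSpectrum.ext ?_
    have hker (q : PrimeSpectrum R') : RingHom.ker (ev q) = q.asIdeal := by
      ext x
      simp [ev, RingHom.mem_ker]
    rw [← hker q, ← hker q', h]
  have hloc (q : PrimeSpectrum R') :
      Function.Bijective (algebraMap K (Localization.AtPrime q.asIdeal)) := by
    refine ⟨(algebraMap K _).injective, ?_⟩
    have key (x : R') : algebraMap R' (Localization.AtPrime q.asIdeal) x ∈
        (algebraMap K (Localization.AtPrime q.asIdeal)).range := by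
      let g : R →ₐ[L] Localization.AtPrime q.asIdeal :=
        (IsScalarTower.toAlgHom L R' _).comp Algebra.TensorProduct.includeRight
      induction x using TensorProduct.induction_on with
      | zero => simp
      | add x y hx hy => rw [map_add]; exact add_mem hx hy
      | tmul a r =>
        have h1 : (a ⊗ₜ[L] r : R') = algebraMap K R' a * (1 ⊗ₜ r) := by simp [R']
        rw [h1, map_mul, ← IsScalarTower.algebraMap_apply]
        exact mul_mem ⟨a, rfl⟩ (hrig _ (hbij q.asIdeal).2 g r)
    intro z
    obtain ⟨x, s, rfl⟩ := IsLocalization.exists_mk'_eq q.asIdeal.primeCompl z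
    obtain ⟨a, ha⟩ := key x
    obtain ⟨b, hb⟩ := key s
    refine ⟨a * b⁻¹, ?_⟩
    have hs := IsLocalization.map_units (Localization.AtPrime q.asIdeal) s
    have hb0 : b ≠ 0 := by
      rintro rfl
      rw [← hb, map_zero] at hs
      exact not_isUnit_zero hs
    rw [IsLocalization.eq_mk'_iff_mul_eq, ← hb, ← map_mul, inv_mul_cancel_right₀ hb0, ha]
  -- Finitely many local rings, all equal to `K`, and `R'` embeds into their product.
  let ι : R' →ₐ[K] PrimeSpectrum.PiLocalization R' :=
    (PrimeSpectrum.toPiLocalization R').restrictScalars K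
  have hι : Function.Injective ι := PrimeSpectrum.toPiLocalization_injective R'
  have hmf (q : PrimeSpectrum R') : Module.Finite K (Localization.AtPrime q.asIdeal) :=
    Module.Finite.of_surjective (Algebra.linearMap K _) (hloc q).2
  have hred (q : PrimeSpectrum R') : IsReduced (Localization.AtPrime q.asIdeal) :=
    isReduced_of_injective (RingEquiv.ofBijective _ (hloc q)).symm
      (RingEquiv.ofBijective _ (hloc q)).symm.injective
  have hfR' : Module.Finite K R' := Module.Finite.of_injective ι.toLinearMap hι
  have hrR' : IsReduced R' := isReduced_of_injective ι hι
  refine ⟨Module.Finite.of_finite_tensorProduct_of_faithfullyFlat K, ?_⟩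
  exact isReduced_of_injective (Algebra.TensorProduct.includeRight : R →ₐ[L] R')
    (Algebra.TensorProduct.includeRight_injective (algebraMap L K).injective)

/-! ### Arcs on affine schemes and points of arc spaces -/

section Series

variable {A B : CommRingCat.{u}}

/-- The arc on `Spec A` parametrized by `Spec B` whose `m`-jets are the truncations of a ring
homomorphism `A → B⟦t⟧`. -/
def arcOfSeries (φ : A →+* B⟦X⟧) : AbsArc (Spec A) (Spec B) :=
  ⟨fun m ↦ inv (specThickening B m) ≫ Spec.map (CommRingCat.ofHom ((truncHom B m).comp φ)),
    fun m ↦ by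
      rw [← cancel_epi (specThickening B m), IsIso.hom_inv_id_assoc,
        ← Category.assoc, ← specThickening_inc, Category.assoc, IsIso.hom_inv_id_assoc,
        ← Spec.map_comp, ← CommRingCat.ofHom_comp, ← RingHom.comp_assoc,
        truncPolyProj_comp_truncHom]⟩

lemma specThickening_arcOfSeries (φ : A →+* B⟦X⟧) (m : ℕ) :
    specThickening B m ≫ (arcOfSeries φ).1 m =
      Spec.map (CommRingCat.ofHom ((truncHom B m).comp φ)) :=
  IsIso.hom_inv_id_assoc _ _

lemma arcOfSeries_injective : Function.Injective (arcOfSeries : (A →+* B⟦X⟧) → _) := by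
  intro φ φ' h
  refine RingHom.ext fun a ↦ truncHom_jointly_injective _ _ fun m ↦ ?_
  have := congr(specThickening B m ≫ ($h).1 m)
  rw [specThickening_arcOfSeries, specThickening_arcOfSeries] at this
  exact congr($(Spec.map_injective this).hom a)

lemma arcOfSeries_surjective (a : AbsArc (Spec A) (Spec B)) :
    ∃ φ : A →+* B⟦X⟧, arcOfSeries φ = a := by
  choose φ hφ using fun m ↦ Spec.map_surjective (specThickening B m ≫ a.1 m)
  obtain ⟨ψ, hψ⟩ := exists_hom_truncHom_eq (fun m ↦ (φ m).hom) (fun m ↦ by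
    have : φ (m + 1) ≫ CommRingCat.ofHom (truncPolyProj B m) = φ m := by
      apply Spec.map_injective
      rw [Spec.map_comp, hφ, hφ, ← Category.assoc, specThickening_inc, Category.assoc, a.2]
    exact congr($(this).hom))
  refine ⟨ψ, ?_⟩
  ext1 m
  rw [← cancel_epi (specThickening B m), specThickening_arcOfSeries, hψ, ← hφ]
  rfl

lemma arcOfSeries_res {C : CommRingCat.{u}} (φ : A →+* B⟦X⟧) (h : B ⟶ C) :
    (arcOfSeries φ).res (Spec.map h) = arcOfSeries ((PowerSeries.map h.hom).comp φ) := by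
  ext1 m
  rw [← cancel_epi (specThickening C m), specThickening_arcOfSeries, AbsArc.res_val,
    ← Category.assoc, ← specThickening_naturality, Category.assoc, specThickening_arcOfSeries,
    ← Spec.map_comp, ← CommRingCat.ofHom_comp, ← RingHom.comp_assoc, truncPolyMap_comp_truncHom,
    RingHom.comp_assoc]

lemma arcOfSeries_comp {A' : CommRingCat.{u}} (φ : A →+* B⟦X⟧) (ψ : A' ⟶ A) :
    (arcOfSeries φ).comp (Spec.map ψ) = arcOfSeries (φ.comp ψ.hom) := by
  ext1 m
  rw [← cancel_epi (specThickening B m), specThickening_arcOfSeries, AbsArc.comp_val,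
    ← Category.assoc, specThickening_arcOfSeries, ← Spec.map_comp]
  rfl

lemma exists_arcOfSeries_comp_eq {X : Scheme.{u}} (j : Spec A ⟶ X) [IsOpenImmersion j]
    (a : AbsArc X (Spec B)) (h : Set.range a.base ⊆ Set.range j) :
    ∃ φ : A →+* B⟦X⟧, (arcOfSeries φ).comp j = a := by
  obtain ⟨b, rfl⟩ := AbsArc.exists_lift j a h
  obtain ⟨φ, rfl⟩ := arcOfSeries_surjective b
  exact ⟨φ, rfl⟩

lemma range_subset_of_isLocalRing [IsLocalRing B] {X : Scheme.{u}} (g : Spec B ⟶ X) (V : X.Opens)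
    (h : g (IsLocalRing.closedPoint B) ∈ V) : Set.range g ⊆ V := by
  rintro _ ⟨x, rfl⟩
  exact ((IsLocalRing.specializes_closedPoint x).map g.continuous).mem_open V.2 h

lemma AbsArc.comp_comp {X Y Z T : Scheme.{u}} (a : AbsArc X T) (f : X ⟶ Y) (g : Y ⟶ Z) :
    (a.comp f).comp g = a.comp (f ≫ g) := by
  ext1 m
  simp

lemma AbsArc.comp_res {X Y T T' : Scheme.{u}} (a : AbsArc X T) (f : X ⟶ Y) (g : T' ⟶ T) :
    (a.comp f).res g = (a.res g).comp f := by
  ext1 m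
  simp

end Series

section Points

variable {S : Scheme.{u}}

/-- The arc on `X` that corresponds to a `T`-valued point of the arc space of `X`. -/
def arcOf (X : Over S) {T : Scheme.{u}} (z : T ⟶ (arcSpace X).left) : AbsArc X.left T :=
  let a : Arc X (Over.mk (z ≫ (arcSpace X).hom)) := arcSpaceEquiv (Over.homMk z)
  ⟨a.jet, a.inc_jet⟩

lemma arcOf_hom (X : Over S) {T : Scheme.{u}} (z : T ⟶ (arcSpace X).left) (m : ℕ) :
    (arcOf X z).1 m ≫ X.hom = thickeningProj m T ≫ z ≫ (arcSpace X).hom :=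
  (arcSpaceEquiv (Over.homMk z : Over.mk (z ≫ (arcSpace X).hom) ⟶ arcSpace X)).jet_hom m

lemma arcOf_left {X T : Over S} (z : T ⟶ arcSpace X) (m : ℕ) :
    (arcOf X z.left).1 m = (arcSpaceEquiv z).jet m := by
  let g : T ⟶ Over.mk (z.left ≫ (arcSpace X).hom) := Over.homMk (𝟙 _)
  have h : z = g ≫ Over.homMk z.left := by
    ext1
    exact (Category.id_comp _).symm
  have := congr_arg (fun a : Arc X T ↦ a.jet m) ((congr_arg arcSpaceEquiv h).trans
    (arcSpaceEquiv_comp _ _))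
  refine Eq.trans ?_ this.symm
  change _ = (thickening m).map (𝟙 _) ≫ _
  rw [CategoryTheory.Functor.map_id, Category.id_comp]
  rfl

lemma arcOf_comp (X : Over S) {T T' : Scheme.{u}} (g : T' ⟶ T) (z : T ⟶ (arcSpace X).left) :
    arcOf X (g ≫ z) = (arcOf X z).res g := by
  ext1 m
  let g' : Over.mk (g ≫ z ≫ (arcSpace X).hom) ⟶ Over.mk (z ≫ (arcSpace X).hom) := Over.homMk g
  let z' : Over.mk (z ≫ (arcSpace X).hom) ⟶ arcSpace X := Over.homMk z
  refine (arcOf_left (g' ≫ z') m).trans ?_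
  rw [arcSpaceEquiv_comp]
  rfl

lemma arcOf_arcSpaceMap {X Y : Over S} (f : X ⟶ Y) {T : Scheme.{u}}
    (z : T ⟶ (arcSpace X).left) :
    arcOf Y (z ≫ (arcSpaceMap f).left) = (arcOf X z).comp f.left := by
  ext1 m
  let z' : Over.mk (z ≫ (arcSpace X).hom) ⟶ arcSpace X := Over.homMk z
  refine (arcOf_left (z' ≫ arcSpaceMap f) m).trans ?_
  rw [arcSpaceEquiv_comp_arcSpaceMap]
  rfl

lemma arcOf_injective (X : Over S) {T : Scheme.{u}} {z z' : T ⟶ (arcSpace X).left}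
    (hS : z ≫ (arcSpace X).hom = z' ≫ (arcSpace X).hom) (h : arcOf X z = arcOf X z') :
    z = z' := by
  let w : Over.mk (z ≫ (arcSpace X).hom) ⟶ arcSpace X := Over.homMk z
  let w' : Over.mk (z ≫ (arcSpace X).hom) ⟶ arcSpace X := Over.homMk z' hS.symm
  suffices w = w' from congr_arg (fun w ↦ w.left) this
  refine arcSpaceEquiv.injective (Arc.ext (funext fun m ↦ ?_))
  rw [← arcOf_left, ← arcOf_left]
  exact congr_fun (congr_arg Subtype.val h) m

lemma exists_arcOf_eq (X : Over S) {T : Scheme.{u}} (a : AbsArc X.left T) (s : T ⟶ S)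
    (hs : ∀ m, a.1 m ≫ X.hom = thickeningProj m T ≫ s) :
    ∃ z : T ⟶ (arcSpace X).left, z ≫ (arcSpace X).hom = s ∧ arcOf X z = a := by
  let b : Arc X (Over.mk s) := ⟨a.1, a.2, hs⟩
  refine ⟨(arcSpaceEquiv.symm b).left, Over.w _, ?_⟩
  ext1 m
  rw [arcOf_left, Equiv.apply_symm_apply]

/-- Points of the arc space of `X` with the same image in that of `Y` have the same structure morphism
to the base, so that they are determined by the underlying arcs. -/
lemma arcOf_eq_of_comp_eq {X Y : Over S} (f : X ⟶ Y) {T : Scheme.{u}}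
    {z z' : T ⟶ (arcSpace X).left}
    (h : z ≫ (arcSpaceMap f).left = z' ≫ (arcSpaceMap f).left) :
    z = z' ↔ arcOf X z = arcOf X z' := by
  refine ⟨fun h ↦ by rw [h], arcOf_injective X ?_⟩
  have := congr($h ≫ (arcSpace Y).hom)
  simpa using this

end Points

/-! ### The ramification locus and the number of lifts of an arc -/

/-- The stalk of the sheaf of differentials, computed with local rings of the source and the
target. -/
lemma subsingleton_kaehlerDifferential_iff_notMem_support {C₀ A O O' : Type*} [CommRing C₀]
    [CommRing A] [CommRing O] [CommRing O'] [Algebra C₀ A] [Algebra A O'] [Algebra C₀ O']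
    [IsScalarTower C₀ A O'] [Algebra C₀ O] [Algebra O O'] [IsScalarTower C₀ O O']
    (M : Submonoid C₀) [IsLocalization M O] (q : PrimeSpectrum A)
    [IsLocalization.AtPrime O' q.asIdeal] :
    Subsingleton Ω[O'⁄O] ↔ q ∉ Module.support A Ω[A⁄C₀] := by
  rw [← Set.mem_compl_iff, ← Algebra.unramifiedLocus_eq_compl_support]
  have h1 : Subsingleton Ω[O'⁄O] ↔ Algebra.FormallyUnramified C₀ O' := by
    have := Algebra.FormallyUnramified.of_isLocalization (Rₘ := O) M
    rw [← Algebra.formallyUnramified_iff]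
    exact ⟨fun _ ↦ .comp C₀ O O', fun _ ↦ .of_restrictScalars C₀ O O'⟩
  rw [h1]
  let e : Localization.AtPrime q.asIdeal ≃ₐ[A] O' := IsLocalization.algEquiv q.asIdeal.primeCompl _ _
  exact ⟨fun _ ↦ .of_equiv (e.restrictScalars C₀).symm, fun (_ : Algebra.IsUnramifiedAt _ _) ↦
    .of_equiv (e.restrictScalars C₀)⟩

lemma mem_ramificationLocus_iff {X Y : Scheme.{u}} (f : X ⟶ Y) {W : Y.Opens} (hW : IsAffineOpen W)
    {V : X.Opens} (hV : IsAffineOpen V) (e : V ≤ f ⁻¹ᵁ W) (q : PrimeSpectrum Γ(X, V)) :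
    letI := (f.appLE W V e).hom.toAlgebra
    hV.fromSpec q ∈ ramificationLocus f ↔ q ∈ Module.support Γ(X, V) Ω[Γ(X, V)⁄Γ(Y, W)] := by
  let := (f.appLE W V e).hom.toAlgebra
  have hx : hV.fromSpec q ∈ V := by
    rw [← SetLike.mem_coe, ← hV.range_fromSpec]
    exact ⟨q, rfl⟩
  obtain ⟨x, hxq⟩ : ∃ x : V, x.1 = hV.fromSpec q := ⟨⟨_, hx⟩, rfl⟩
  have hq : q = hV.primeIdealOf x :=
    hV.fromSpec.isOpenEmbedding.injective (by rw [hV.fromSpec_primeIdealOf, hxq])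
  rw [← hxq, hq]
  let y : W := ⟨f x, e x.2⟩
  let : Algebra Γ(X, V) (X.presheaf.stalk x.1) := (X.presheaf.germ V x x.2).hom.toAlgebra
  let : Algebra Γ(Y, W) (Y.presheaf.stalk (f x)) := (Y.presheaf.germ W (f x) y.2).hom.toAlgebra
  let : Algebra (Y.presheaf.stalk (f x)) (X.presheaf.stalk x.1) := (f.stalkMap x).hom.toAlgebra
  let : Algebra Γ(Y, W) (X.presheaf.stalk x.1) :=
    (f.appLE W V e ≫ X.presheaf.germ V x x.2).hom.toAlgebra
  have : IsScalarTower Γ(Y, W) Γ(X, V) (X.presheaf.stalk x.1) := .of_algebraMap_eq' rfl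
  have : IsScalarTower Γ(Y, W) (Y.presheaf.stalk (f x)) (X.presheaf.stalk x.1) :=
    .of_algebraMap_eq' (by
      change (f.appLE W V e ≫ X.presheaf.germ V x x.2).hom =
        (Y.presheaf.germ W (f x) y.2 ≫ f.stalkMap x).hom
      congr 1
      rw [Scheme.Hom.germ_stalkMap, Scheme.Hom.appLE, Category.assoc, TopCat.Presheaf.germ_res])
  have h1 : IsLocalization.AtPrime (X.presheaf.stalk x.1) (hV.primeIdealOf x).asIdeal :=
    hV.isLocalization_stalk x
  have h2 : IsLocalization (hW.primeIdealOf y).asIdeal.primeCompl (Y.presheaf.stalk (f x)) :=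
    hW.isLocalization_stalk y
  have := subsingleton_kaehlerDifferential_iff_notMem_support (C₀ := Γ(Y, W)) (A := Γ(X, V))
    (O := Y.presheaf.stalk (f x)) (O' := X.presheaf.stalk x.1)
    (hW.primeIdealOf y).asIdeal.primeCompl (hV.primeIdealOf x)
  rw [← not_iff_not, ← this, ← not_nontrivial_iff_subsingleton]
  rfl

lemma exists_isAffineOpen_le_preimage {X Y : Scheme.{u}} (f : X ⟶ Y) (x : X) :
    ∃ (W : Y.Opens) (V : X.Opens), IsAffineOpen W ∧ IsAffineOpen V ∧ V ≤ f ⁻¹ᵁ W ∧ x ∈ V := by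
  obtain ⟨_, ⟨W, hW, rfl⟩, hxW, -⟩ :=
    Y.isBasis_affineOpens.exists_subset_of_mem_open (Set.mem_univ (f x)) isOpen_univ
  obtain ⟨_, ⟨V, hV, rfl⟩, hxV, hVW⟩ :=
    X.isBasis_affineOpens.exists_subset_of_mem_open (show x ∈ (f ⁻¹ᵁ W : Set X) from hxW)
      (f ⁻¹ᵁ W).isOpen
  exact ⟨W, V, hW, hV, hVW, hxV⟩

theorem isClosed_ramificationLocus {X Y : Scheme.{u}} (f : X ⟶ Y) [LocallyOfFiniteType f] :
    IsClosed (ramificationLocus f) := by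
  rw [← isOpen_compl_iff, isOpen_iff_forall_mem_open]
  intro x hx
  obtain ⟨W, V, hW, hV, e, hxV⟩ := exists_isAffineOpen_le_preimage f x
  algebraize [(f.appLE W V e).hom]
  have : Algebra.FiniteType Γ(Y, W) Γ(X, V) := f.finiteType_appLE hW hV e
  have hc : IsClosed (Module.support Γ(X, V) Ω[Γ(X, V)⁄Γ(Y, W)]) := by
    rw [Module.support_eq_zeroLocus]
    exact PrimeSpectrum.isClosed_zeroLocus _
  have hmem := mem_ramificationLocus_iff f hW hV e
  refine ⟨hV.fromSpec '' (Module.support Γ(X, V) Ω[Γ(X, V)⁄Γ(Y, W)])ᶜ, ?_,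
    hV.fromSpec.isOpenEmbedding.isOpenMap _ hc.isOpen_compl, ?_⟩
  · rintro _ ⟨q, hq, rfl⟩
    exact fun h ↦ hq ((hmem q).mp h)
  · rw [← SetLike.mem_coe, ← hV.range_fromSpec] at hxV
    obtain ⟨q, rfl⟩ := hxV
    exact ⟨q, fun h ↦ hx ((hmem q).mpr h), rfl⟩

lemma arcOfSeries_fromSpec_comp {X Y : Scheme.{u}} (f : X ⟶ Y) {W : Y.Opens} (hW : IsAffineOpen W)
    {V : X.Opens} (hV : IsAffineOpen V) (e : V ≤ f ⁻¹ᵁ W) {B : CommRingCat.{u}}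
    (φ : Γ(X, V) →+* B⟦X⟧) :
    ((arcOfSeries φ).comp hV.fromSpec).comp f =
      (arcOfSeries (φ.comp (f.appLE W V e).hom)).comp hW.fromSpec := by
  rw [AbsArc.comp_comp, ← IsAffineOpen.SpecMap_appLE_fromSpec f hW hV e, ← AbsArc.comp_comp,
    arcOfSeries_comp]

lemma arcOfSeries_fromSpec_injective {X : Scheme.{u}} {V : X.Opens} (hV : IsAffineOpen V)
    {B : CommRingCat.{u}} :
    Function.Injective fun φ : Γ(X, V) →+* B⟦X⟧ ↦ (arcOfSeries φ).comp hV.fromSpec :=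
  fun _ _ h ↦ arcOfSeries_injective (AbsArc.comp_injective _ h)

lemma exists_arcOfSeries_fromSpec {X : Scheme.{u}} {V : X.Opens} (hV : IsAffineOpen V)
    {B : CommRingCat.{u}} (a : AbsArc X (Spec B)) (h : Set.range a.base ⊆ V) :
    ∃ φ : Γ(X, V) →+* B⟦X⟧, (arcOfSeries φ).comp hV.fromSpec = a :=
  exists_arcOfSeries_comp_eq _ a (by rwa [hV.range_fromSpec])

/-- An arc over a field lies in each affine chart that contains its closed point, where it is a
homomorphism to the domain `Ω⟦X⟧`; finitely many charts cover `X`. -/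
theorem exists_ncard_absArc_le {X Y : Scheme.{u}} (f : X ⟶ Y) [LocallyOfFiniteType f]
    [LocallyQuasiFinite f] [CompactSpace X] :
    ∃ d : ℕ, ∀ (Ω : Type u) [Field Ω] (b : AbsArc Y (Spec (.of Ω))),
      {a : AbsArc X (Spec (.of Ω)) | a.comp f = b}.Finite ∧
      {a : AbsArc X (Spec (.of Ω)) | a.comp f = b}.ncard ≤ d := by
  choose W V hW hV e hxV using exists_isAffineOpen_le_preimage f
  obtain ⟨t, ht⟩ := CompactSpace.elim_nhds_subcover (fun x ↦ (V x : Set X))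
    fun x ↦ (V x).isOpen.mem_nhds (hxV x)
  have key (x : X) : ∃ d : ℕ, ∀ (Ω : Type u) [Field Ω] (c : Γ(Y, W x) →+* Ω⟦X⟧),
      {φ : Γ(X, V x) →+* Ω⟦X⟧ | φ.comp (f.appLE (W x) (V x) (e x)).hom = c}.Finite ∧
      {φ : Γ(X, V x) →+* Ω⟦X⟧ | φ.comp (f.appLE (W x) (V x) (e x)).hom = c}.ncard ≤ d := by
    algebraize [(f.appLE (W x) (V x) (e x)).hom]
    have : Algebra.FiniteType Γ(Y, W x) Γ(X, V x) := f.finiteType_appLE (hW x) (hV x) (e x)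
    have : Algebra.QuasiFinite Γ(Y, W x) Γ(X, V x) :=
      LocallyQuasiFinite.quasiFinite_appLE (f := f) (hW x) (hV x) (e x)
    obtain ⟨d, hd⟩ := exists_ncard_ringHom_le_of_quasiFinite.{u} Γ(Y, W x) Γ(X, V x)
    exact ⟨d, fun Ω _ c ↦ hd Ω⟦X⟧ c⟩
  choose d hd using key
  refine ⟨∑ x ∈ t, d x, fun Ω _ b ↦ ?_⟩
  let T (x : X) : Set (AbsArc X (Spec (.of Ω))) := {a | a.comp f = b ∧ Set.range a.base ⊆ V x}
  have hT : {a : AbsArc X (Spec (.of Ω)) | a.comp f = b} = ⋃ x ∈ t, T x := by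
    ext a
    simp only [Set.mem_iUnion, T, Set.mem_ofPred_eq]
    refine ⟨fun ha ↦ ?_, fun ⟨_, _, ha, _⟩ ↦ ha⟩
    have : a.base (IsLocalRing.closedPoint Ω) ∈ ⋃ x ∈ t, (V x : Set X) := ht ▸ trivial
    simp only [Set.mem_iUnion] at this
    obtain ⟨x, hx, hax⟩ := this
    exact ⟨x, hx, ha, range_subset_of_isLocalRing (B := .of Ω) _ _ hax⟩
  have hTx (x : X) : (T x).Finite ∧ (T x).ncard ≤ d x := by
    obtain h | ⟨a₀, ha₀, ha₀'⟩ := (T x).eq_empty_or_nonempty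
    · simp [h]
    obtain ⟨φ₀, rfl⟩ := exists_arcOfSeries_fromSpec (hV x) a₀ ha₀'
    let c := φ₀.comp (f.appLE (W x) (V x) (e x)).hom
    have hsub : T x ⊆ (fun φ ↦ (arcOfSeries φ).comp (hV x).fromSpec) ''
        {φ : Γ(X, V x) →+* Ω⟦X⟧ | φ.comp (f.appLE (W x) (V x) (e x)).hom = c} := by
      rintro a ⟨ha, ha'⟩
      obtain ⟨φ, rfl⟩ := exists_arcOfSeries_fromSpec (hV x) a ha'
      refine ⟨φ, ?_, rfl⟩
      refine arcOfSeries_fromSpec_injective (B := .of Ω) (hW x) ?_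
      simp only [c]
      rw [← arcOfSeries_fromSpec_comp f (hW x) (hV x) (e x) (B := .of Ω),
        ← arcOfSeries_fromSpec_comp f (hW x) (hV x) (e x) (B := .of Ω), ha, ha₀]
    have hfin := (hd x Ω c).1.image fun φ ↦ (arcOfSeries (B := .of Ω) φ).comp (hV x).fromSpec
    refine ⟨hfin.subset hsub, (Set.ncard_le_ncard hsub hfin).trans ?_⟩
    exact (Set.ncard_image_le (hd x Ω c).1).trans (hd x Ω c).2
  rw [hT]
  refine ⟨t.finite_toSet.biUnion fun x _ ↦ (hTx x).1, ?_⟩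
  exact (Finset.set_ncard_biUnion_le t T).trans (Finset.sum_le_sum fun x _ ↦ (hTx x).2)

theorem exists_ncard_arcSpace_lift_le {S : Scheme.{u}} {X Y : Over S} (f : X ⟶ Y)
    [LocallyOfFiniteType f.left] [LocallyQuasiFinite f.left] [CompactSpace X.left] :
    ∃ d : ℕ, ∀ (Ω : Type u) [Field Ω] (b : Spec (.of Ω) ⟶ (arcSpace Y).left),
      {z : Spec (.of Ω) ⟶ (arcSpace X).left | z ≫ (arcSpaceMap f).left = b}.Finite ∧
      {z : Spec (.of Ω) ⟶ (arcSpace X).left | z ≫ (arcSpaceMap f).left = b}.ncard ≤ d := by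
  obtain ⟨d, hd⟩ := exists_ncard_absArc_le f.left
  refine ⟨d, fun Ω _ b ↦ ?_⟩
  obtain ⟨hfin, hcard⟩ := hd Ω (arcOf Y b)
  have hmaps : Set.MapsTo (arcOf X)
      {z : Spec (.of Ω) ⟶ (arcSpace X).left | z ≫ (arcSpaceMap f).left = b}
      {a : AbsArc X.left (Spec (.of Ω)) | a.comp f.left = arcOf Y b} := by
    rintro z rfl
    exact (arcOf_arcSpaceMap f z).symm
  have hinj : Set.InjOn (arcOf X)
      {z : Spec (.of Ω) ⟶ (arcSpace X).left | z ≫ (arcSpaceMap f).left = b} :=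
    fun z hz z' hz' h ↦ (arcOf_eq_of_comp_eq f (hz.trans hz'.symm)).mpr h
  exact ⟨.of_injOn hmaps hinj hfin, (Set.ncard_le_ncard_of_injOn _ hmaps hinj hfin).trans hcard⟩

/-! ### Arcs on closed subschemes and rigidity of arcs -/

lemma arcOf_base {S : Scheme.{u}} (X : Over S) {T : Scheme.{u}} (z : T ⟶ (arcSpace X).left) :
    (arcOf X z).base = z ≫ (arcOf X (𝟙 _)).base := by
  conv_lhs => rw [← Category.comp_id z, arcOf_comp, AbsArc.base_res]

section ClosedSubscheme

variable {S : Scheme.{u}} {R X : Over S} (i : R ⟶ X) [IsClosedImmersion i.left]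
  {V : X.left.Opens} (hV : IsAffineOpen V)

/-- An arc on `V` that kills the ideal of the closed subscheme `R` is an arc on `R`. -/
lemma range_subset_range_arcSpaceMap_of_ker_le {B : CommRingCat.{u}}
    (z : Spec B ⟶ (arcSpace X).left) (φ : Γ(X.left, V) →+* B⟦X⟧)
    (hφ : (arcOfSeries φ).comp hV.fromSpec = arcOf X z)
    (h : RingHom.ker (i.left.app V).hom ≤ RingHom.ker φ) :
    Set.range z ⊆ Set.range (arcSpaceMap i).left := by
  let ρ : Γ(R.left, i.left ⁻¹ᵁ V) →+* B⟦X⟧ :=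
    (i.left.app V).hom.liftOfSurjective (i.left.app_surjective V hV) ⟨φ, h⟩
  have hρ : ρ.comp (i.left.appLE V _ le_rfl).hom = φ := by
    rw [← Scheme.Hom.app_eq_appLE]
    exact RingHom.liftOfRightInverse_comp _ _ _ _
  let r : AbsArc R.left (Spec B) := (arcOfSeries ρ).comp (hV.preimage i.left).fromSpec
  have hr : r.comp i.left = arcOf X z := by
    rw [arcOfSeries_fromSpec_comp i.left hV (hV.preimage i.left) le_rfl, hρ, hφ]
  obtain ⟨w, hw, hwr⟩ := exists_arcOf_eq R r (z ≫ (arcSpace X).hom) fun m ↦ by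
    rw [← Over.w i, ← Category.assoc, ← AbsArc.comp_val, hr, arcOf_hom]
  have : w ≫ (arcSpaceMap i).left = z := by
    refine arcOf_injective X ?_ ?_
    · rw [Category.assoc, Over.w, hw]
    · rw [arcOf_arcSpaceMap, hwr, hr]
  rw [← this]
  rintro _ ⟨x, rfl⟩
  exact ⟨w x, (Scheme.Hom.comp_apply _ _ _).symm⟩

/-- Over a field, the image of a point in the arc space of `R` is detected by the ideal of `R`: after
an extension of the field the arc itself lifts to `R`. -/
lemma ker_le_of_mem_range_arcSpaceMap {Ω : Type u} [Field Ω]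
    (z : Spec (.of Ω) ⟶ (arcSpace X).left) (φ : Γ(X.left, V) →+* Ω⟦X⟧)
    (hφ : (arcOfSeries (B := .of Ω) φ).comp hV.fromSpec = arcOf X z) (x : Spec (.of Ω))
    (h : z x ∈ Set.range (arcSpaceMap i).left) :
    RingHom.ker (i.left.app V).hom ≤ RingHom.ker φ := by
  obtain ⟨r, hr⟩ := h
  obtain ⟨p, -, -⟩ := Scheme.Pullback.exists_preimage_pullback x r hr.symm
  let P := pullback z (arcSpaceMap i).left
  let Ω' := P.residueField p
  obtain ⟨h, hh⟩ := Spec.map_surjective (P.fromSpecResidueField p ≫ pullback.fst _ _)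
  let w : Spec Ω' ⟶ (arcSpace R).left := P.fromSpecResidueField p ≫ pullback.snd _ _
  have hw : w ≫ (arcSpaceMap i).left = Spec.map h ≫ z := by
    rw [hh, Category.assoc, Category.assoc, pullback.condition]
  have hwφ : (arcOf R w).comp i.left =
      (arcOfSeries ((PowerSeries.map h.hom).comp φ)).comp hV.fromSpec := by
    rw [← arcOf_arcSpaceMap, hw, arcOf_comp, ← hφ, AbsArc.comp_res, arcOfSeries_res]
  obtain ⟨ρ, hρ⟩ := exists_arcOfSeries_fromSpec (hV.preimage i.left) (arcOf R w) (by
    rintro _ ⟨y, rfl⟩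
    change i.left ((arcOf R w).base y) ∈ V
    rw [← Scheme.Hom.comp_apply, ← AbsArc.base_comp, hwφ, AbsArc.base_comp, Scheme.Hom.comp_apply,
      ← SetLike.mem_coe, ← hV.range_fromSpec]
    exact ⟨_, rfl⟩)
  rw [← hρ, arcOfSeries_fromSpec_comp i.left hV (hV.preimage i.left) le_rfl] at hwφ
  have hρφ := arcOfSeries_fromSpec_injective hV hwφ
  intro a ha
  rw [RingHom.mem_ker] at ha ⊢
  rw [← Scheme.Hom.app_eq_appLE] at hρφ
  have h1 := RingHom.congr_fun hρφ a
  rw [RingHom.comp_apply, ha, map_zero, RingHom.comp_apply] at h1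
  have hinj : Function.Injective (PowerSeries.map h.hom) := by
    intro s s' hs
    ext n
    exact h.hom.injective (by simpa using congr(PowerSeries.coeff n $hs))
  exact (map_eq_zero_iff _ hinj).mp h1.symm

/-- In an affine chart of the arc space, the image of the arc space of `R` is the zero locus of all
coefficients of the universal arc at the elements of the ideal of `R`. -/
theorem isClosed_range_arcSpaceMap : IsClosed (Set.range (arcSpaceMap i).left) := by
  rw [← isOpen_compl_iff, isOpen_iff_forall_mem_open]
  intro z₀ hz₀
  let b : (arcSpace X).left ⟶ X.left := (arcOf X (𝟙 _)).base
  obtain ⟨_, ⟨V, hV, rfl⟩, hzV, -⟩ :=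
    X.left.isBasis_affineOpens.exists_subset_of_mem_open (Set.mem_univ (b z₀)) isOpen_univ
  obtain ⟨_, ⟨N, hN, rfl⟩, hzN, hNV⟩ :=
    (arcSpace X).left.isBasis_affineOpens.exists_subset_of_mem_open
      (show z₀ ∈ (b ⁻¹ᵁ V : Set (arcSpace X).left) from hzV) (b ⁻¹ᵁ V).isOpen
  replace hN : IsAffineOpen N := hN
  have : IsOpenImmersion hN.fromSpec := inferInstance
  obtain ⟨φ, hφ⟩ := exists_arcOfSeries_fromSpec hV (arcOf X hN.fromSpec) (by
    rw [arcOf_base]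
    rintro _ ⟨x, rfl⟩
    rw [Scheme.Hom.comp_apply]
    refine hNV ?_
    rw [← hN.range_fromSpec]
    exact ⟨x, rfl⟩)
  let Z : Set (PrimeSpectrum Γ((arcSpace X).left, N)) := PrimeSpectrum.zeroLocus
    {c | ∃ a ∈ RingHom.ker (i.left.app V).hom, ∃ n, c = PowerSeries.coeff n (φ a)}
  have key (P : PrimeSpectrum Γ((arcSpace X).left, N)) :
      hN.fromSpec P ∈ Set.range (arcSpaceMap i).left ↔ P ∈ Z := by
    let κ := P.asIdeal.ResidueField
    let h : Γ((arcSpace X).left, N) ⟶ .of κ := CommRingCat.ofHom (algebraMap _ κ)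
    have hpt (x : Spec (.of κ)) : Spec.map h x = P := by
      apply PrimeSpectrum.ext
      have : x.asIdeal = ⊥ := congr_arg PrimeSpectrum.asIdeal
        (Subsingleton.elim (α := PrimeSpectrum κ) x ⊥)
      change Ideal.comap (algebraMap _ κ) x.asIdeal = _
      rw [this, ← RingHom.ker_eq_comap_bot, Ideal.ker_algebraMap_residueField]
    have hser : (arcOfSeries ((PowerSeries.map h.hom).comp φ)).comp hV.fromSpec =
        arcOf X (Spec.map h ≫ hN.fromSpec) := by
      rw [arcOf_comp, ← hφ, AbsArc.comp_res, arcOfSeries_res]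
    have hZ : P ∈ Z ↔ RingHom.ker (i.left.app V).hom ≤
        RingHom.ker ((PowerSeries.map h.hom).comp φ) := by
      rw [PrimeSpectrum.mem_zeroLocus]
      constructor
      · intro hP a ha
        rw [RingHom.mem_ker]
        ext n
        exact Ideal.algebraMap_residueField_eq_zero.mpr (hP ⟨a, ha, n, rfl⟩)
      · rintro hP _ ⟨a, ha, n, rfl⟩
        exact Ideal.algebraMap_residueField_eq_zero.mp
          congr(PowerSeries.coeff n $(RingHom.mem_ker.mp (hP ha)))
    let x₀ : Spec (.of κ) := IsLocalRing.closedPoint κ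
    have hx₀ : (Spec.map h ≫ hN.fromSpec) x₀ = hN.fromSpec P := by
      rw [Scheme.Hom.comp_apply, hpt]
    rw [hZ, ← hx₀]
    exact ⟨ker_le_of_mem_range_arcSpaceMap i hV _ _ hser x₀,
      fun hle ↦ range_subset_range_arcSpaceMap_of_ker_le i hV _ _ hser hle ⟨x₀, rfl⟩⟩
  refine ⟨hN.fromSpec '' Zᶜ, ?_, hN.fromSpec.isOpenEmbedding.isOpenMap _
    (PrimeSpectrum.isClosed_zeroLocus _).isOpen_compl, ?_⟩
  · rintro _ ⟨P, hP, rfl⟩ h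
    exact hP ((key P).mp h)
  · rw [← hN.range_fromSpec] at hzN
    obtain ⟨P, rfl⟩ := hzN
    exact ⟨P, fun h ↦ hz₀ ((key P).mpr h), rfl⟩

end ClosedSubscheme

/-- The generic point of an arc over a field that does not lie on the ramification locus is outside
of that locus, so that the relative differentials are annihilated by a function that does not vanish
on the arc. -/
lemma exists_smul_kaehlerDifferential_eq_zero {S : Scheme.{u}} {R X Y : Over S} (f : X ⟶ Y)
    [LocallyOfFiniteType f.left] (i : R ⟶ X) [IsClosedImmersion i.left]
    (hi : Set.range i.left = ramificationLocus f.left) {W : Y.left.Opens} (hW : IsAffineOpen W)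
    {V : X.left.Opens} (hV : IsAffineOpen V) (e : V ≤ f.left ⁻¹ᵁ W) {Ω : Type u} [Field Ω]
    (z : Spec (.of Ω) ⟶ (arcSpace X).left) (φ : Γ(X.left, V) →+* Ω⟦X⟧)
    (hφ : (arcOfSeries (B := .of Ω) φ).comp hV.fromSpec = arcOf X z) (x : Spec (.of Ω))
    (h : z x ∉ Set.range (arcSpaceMap i).left) :
    letI := (f.left.appLE W V e).hom.toAlgebra
    ∃ a : Γ(X.left, V), φ a ≠ 0 ∧ ∀ ω : Ω[Γ(X.left, V)⁄Γ(Y.left, W)], a • ω = 0 := by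
  have hmem := mem_ramificationLocus_iff f.left hW hV e
  algebraize [(f.left.appLE W V e).hom]
  have : Algebra.FiniteType Γ(Y.left, W) Γ(X.left, V) := f.left.finiteType_appLE hW hV e
  let q : PrimeSpectrum Γ(X.left, V) := ⟨RingHom.ker φ, RingHom.ker_isPrime φ⟩
  have hq : hV.fromSpec q ∉ ramificationLocus f.left := by
    rw [← hi]
    rintro ⟨r, hr⟩
    refine h (range_subset_range_arcSpaceMap_of_ker_le i hV z φ hφ ?_ ⟨x, rfl⟩)
    have hrV : r ∈ i.left ⁻¹ᵁ V := by
      change i.left r ∈ V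
      rw [hr, ← SetLike.mem_coe, ← hV.range_fromSpec]
      exact ⟨q, rfl⟩
    rw [← SetLike.mem_coe, ← (hV.preimage i.left).range_fromSpec] at hrV
    obtain ⟨q', rfl⟩ := hrV
    rw [← Scheme.Hom.comp_apply, ← IsAffineOpen.SpecMap_appLE_fromSpec i.left hV
      (hV.preimage i.left) le_rfl, Scheme.Hom.comp_apply] at hr
    have hr' := hV.fromSpec.isOpenEmbedding.injective hr
    intro a ha
    change a ∈ q.asIdeal
    rw [← hr']
    change (i.left.appLE V _ le_rfl).hom a ∈ q'.asIdeal
    rw [← Scheme.Hom.app_eq_appLE, RingHom.mem_ker.mp ha]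
    exact zero_mem _
  have hq' := (hmem q).not.mp hq
  rw [Module.support_eq_zeroLocus, PrimeSpectrum.mem_zeroLocus, Set.not_subset] at hq'
  obtain ⟨a, ha, haq⟩ := hq'
  exact ⟨a, haq, fun ω ↦ Module.mem_annihilator.mp ha ω⟩

/-- Outside of the arc space of the ramification locus, the map of arc spaces is rigid: a point over a
local `K`-algebra `C` is constant if it is constant modulo the maximal ideal and its image in the arc
space of `Y` is constant. -/
theorem arcSpace_hom_ext_of_isLocalRing {S : Scheme.{u}} {R X Y : Over S} (f : X ⟶ Y)
    [LocallyOfFiniteType f.left] (i : R ⟶ X) [IsClosedImmersion i.left]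
    (hi : Set.range i.left = ramificationLocus f.left) {C : CommRingCat.{u}} [IsLocalRing C]
    {K : Type u} [Field K] (ι : .of K ⟶ C) (z : Spec C ⟶ (arcSpace X).left)
    (z₀ : Spec (.of K) ⟶ (arcSpace X).left)
    (hY : z ≫ (arcSpaceMap f).left = (Spec.map ι ≫ z₀) ≫ (arcSpaceMap f).left)
    (hres : Spec.map (CommRingCat.ofHom (IsLocalRing.residue C)) ≫ z =
      Spec.map (CommRingCat.ofHom (IsLocalRing.residue C)) ≫ Spec.map ι ≫ z₀)
    (hU : ∀ x, z₀ x ∉ Set.range (arcSpaceMap i).left) : z = Spec.map ι ≫ z₀ := by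
  -- Both points lie in the chart `V` around the closed point, hence are power series there.
  let x₀ : Spec (.of K) := IsLocalRing.closedPoint K
  obtain ⟨W, V, hW, hV, e, hxV⟩ := exists_isAffineOpen_le_preimage f.left ((arcOf X z₀).base x₀)
  have hbase (y : Spec C) : (arcOf X (Spec.map ι ≫ z₀)).base y ∈ V := by
    rw [arcOf_comp, AbsArc.base_res, Scheme.Hom.comp_apply]
    exact range_subset_of_isLocalRing (B := .of K) _ V hxV ⟨_, rfl⟩
  let ρ : C ⟶ .of (IsLocalRing.ResidueField C) := CommRingCat.ofHom (IsLocalRing.residue C)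
  let y₀ : Spec (.of (IsLocalRing.ResidueField C)) := IsLocalRing.closedPoint _
  have hy₀ : Spec.map ρ y₀ = IsLocalRing.closedPoint C := IsLocalRing.PrimeSpectrum.comap_residue _ _
  obtain ⟨φ₀, hφ₀⟩ := exists_arcOfSeries_fromSpec hV (arcOf X z₀)
    (range_subset_of_isLocalRing (B := .of K) _ V hxV)
  obtain ⟨φ, hφ⟩ := exists_arcOfSeries_fromSpec hV (arcOf X z) (by
    refine range_subset_of_isLocalRing _ V ?_
    have := hbase (IsLocalRing.closedPoint C)
    rw [← hy₀, arcOf_base, Scheme.Hom.comp_apply, ← Scheme.Hom.comp_apply (Spec.map ρ)] at this ⊢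
    rwa [hres])
  have hφ₀' : (arcOfSeries ((PowerSeries.map ι.hom).comp φ₀)).comp hV.fromSpec =
      arcOf X (Spec.map ι ≫ z₀) := by
    rw [arcOf_comp, ← hφ₀, AbsArc.comp_res, arcOfSeries_res]
  refine (arcOf_eq_of_comp_eq f hY).mpr ?_
  rw [← hφ, ← hφ₀']
  suffices φ = (PowerSeries.map ι.hom).comp φ₀ by rw [this]
  obtain ⟨a, ha, haω⟩ := exists_smul_kaehlerDifferential_eq_zero f i hi hW hV e z₀ φ₀ hφ₀ x₀ (hU x₀)
  algebraize [(f.left.appLE W V e).hom]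
  have : Algebra.FiniteType Γ(Y.left, W) Γ(X.left, V) := f.left.finiteType_appLE hW hV e
  have h₀ : φ.comp (f.left.appLE W V e).hom =
      ((PowerSeries.map ι.hom).comp φ₀).comp (f.left.appLE W V e).hom := by
    apply arcOfSeries_fromSpec_injective hW
    have := congr_arg (arcOf Y) hY
    rw [arcOf_arcSpaceMap, arcOf_arcSpaceMap, ← hφ, ← hφ₀', arcOfSeries_fromSpec_comp _ hW hV e,
      arcOfSeries_fromSpec_comp _ hW hV e] at this
    exact this
  have hm : (PowerSeries.map ρ.hom).comp φ =
      (PowerSeries.map ρ.hom).comp ((PowerSeries.map ι.hom).comp φ₀) := by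
    apply arcOfSeries_fromSpec_injective hV
    have := congr_arg (arcOf X) hres
    rw [arcOf_comp, arcOf_comp, ← hφ, ← hφ₀', AbsArc.comp_res, AbsArc.comp_res, arcOfSeries_res,
      arcOfSeries_res] at this
    exact this
  -- Over the field `K`, a nonzero power series is a power of `X` times a unit.
  obtain ⟨N, c, hc, hcN⟩ : ∃ (N : ℕ) (c : K⟦X⟧), IsUnit c ∧ φ₀ a = PowerSeries.X ^ N * c := by
    refine ⟨PowerSeries.order (R := K) (φ₀ a) |>.toNat, PowerSeries.divXPowOrder (φ₀ a), ?_, ?_⟩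
    · exact PowerSeries.isUnit_divided_by_X_pow_order (k := K) ha
    · exact PowerSeries.X_pow_order_mul_divXPowOrder.symm
  refine ext_of_kaehlerDifferential (C₀ := Γ(Y.left, W)) _ _ h₀ (fun b n ↦ ?_) a haω N
    (PowerSeries.map ι.hom c) (hc.map _) ?_
  · rw [← IsLocalRing.residue_eq_zero_iff, map_sub, map_sub, sub_eq_zero]
    exact congr(PowerSeries.coeff n ($hm b))
  · rw [RingHom.comp_apply, hcN]
    simp

/-! ### Schemes over a field with finitely many points in each field -/

lemma isMaximal_of_finite_algHom (L R : Type u) [Field L] [CommRing R] [Algebra L R]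
    (hfin : ∀ (Ω : Type u) [Field Ω] [Algebra L Ω], Finite (R →ₐ[L] Ω)) (p : Ideal R) [p.IsPrime] :
    p.IsMaximal := by
  have : Algebra.IsAlgebraic L p.ResidueField :=
    isAlgebraic_of_finite_algHom L _ fun Ω _ _ ↦
      have := hfin Ω
      Finite.of_injective _ (residueField_algHom_injective p)
  have : Algebra.IsAlgebraic L (R ⧸ p) :=
    .of_injective (IsScalarTower.toAlgHom L (R ⧸ p) p.ResidueField)
      (IsFractionRing.injective (R ⧸ p) p.ResidueField)
  exact Ideal.Quotient.maximal_of_isField _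
    (isField_of_isIntegral_of_isField' (Field.toIsField L))

section Geometric

variable {L : Type u} [Field L] {F : Scheme.{u}} (p : F ⟶ Spec (.of L))

lemma finite_algHom_of_finite_lift
    (hp : ∀ (Ω : Type u) [Field Ω] (γ : .of L ⟶ .of Ω),
      {z : Spec (.of Ω) ⟶ F | z ≫ p = Spec.map γ}.Finite)
    {R : CommRingCat.{u}} (j : Spec R ⟶ F) [Mono j] (φ : .of L ⟶ R) (hφ : Spec.map φ = j ≫ p)
    (Ω : Type u) [Field Ω] [Algebra L Ω] :
    letI := φ.hom.toAlgebra
    Finite (R →ₐ[L] Ω) := by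
  let := φ.hom.toAlgebra
  have := (hp Ω (CommRingCat.ofHom (algebraMap L Ω))).to_subtype
  refine Finite.of_injective (β := {z : Spec (.of Ω) ⟶ F | z ≫ p =
    Spec.map (CommRingCat.ofHom (algebraMap L Ω))})
    (fun g ↦ ⟨Spec.map (CommRingCat.ofHom g.toRingHom) ≫ j, ?_⟩) fun g g' h ↦ ?_
  · change (_ ≫ j) ≫ p = _
    rw [Category.assoc, ← hφ, ← Spec.map_comp]
    congr 1
    ext x
    exact g.commutes x
  · have := Spec.map_injective ((cancel_mono j).mp (congr_arg Subtype.val h))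
    exact AlgHom.ext fun x ↦ congr($(this).hom x)

/-- Over an algebraic closure of the base field `L`, each point `x` has a geometric point above it,
because its residue field is algebraic over `L`: a transcendental extension has infinitely many
embeddings into its algebraic closure. -/
theorem isTopologicallyFinite_of_ncard_lift_le (d : ℕ)
    (hp : ∀ (Ω : Type u) [Field Ω] (γ : .of L ⟶ .of Ω),
      {z : Spec (.of Ω) ⟶ F | z ≫ p = Spec.map γ}.Finite ∧
      {z : Spec (.of Ω) ⟶ F | z ≫ p = Spec.map γ}.ncard ≤ d) :
    IsTopologicallyFinite F ∧ Nat.card F ≤ d := by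
  let K := AlgebraicClosure L
  let T := {z : Spec (.of K) ⟶ F | z ≫ p = Spec.map (CommRingCat.ofHom (algebraMap L K))}
  have hpt (x : F) : ∃ z : T, z.1 (IsLocalRing.closedPoint K) = x := by
    obtain ⟨φ, hφ⟩ := Spec.map_surjective (F.fromSpecResidueField x ≫ p)
    let : Algebra L (F.residueField x) := φ.hom.toAlgebra
    have : Algebra.IsAlgebraic L (F.residueField x) := isAlgebraic_of_finite_algHom _ _ fun Ω _ _ ↦
      finite_algHom_of_finite_lift p (fun Ω _ γ ↦ (hp Ω γ).1) _ φ hφ Ω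
    let g : F.residueField x →ₐ[L] K := IsAlgClosed.lift
    refine ⟨⟨Spec.map (CommRingCat.ofHom g.toRingHom) ≫ F.fromSpecResidueField x, ?_⟩, ?_⟩
    · change (_ ≫ F.fromSpecResidueField x) ≫ p = _
      rw [Category.assoc, ← hφ, ← Spec.map_comp]
      congr 1
      ext x
      exact g.commutes x
    · exact (Scheme.Hom.comp_apply _ _ _).trans (Scheme.fromSpecResidueField_apply _ _)
  choose s hs using hpt
  have hs' : Function.Injective s := fun x y h ↦ by rw [← hs x, h, hs]
  obtain ⟨hT, hTd⟩ := hp K (CommRingCat.ofHom (algebraMap L K))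
  have := hT.to_subtype
  have hF : Finite F := Finite.of_injective s hs'
  -- Primes in affine charts are maximal, so that there are no proper specializations.
  have : T1Space F := by
    rw [t1Space_iff_specializes_imp_eq]
    intro x y h
    obtain ⟨i, Q, hQ⟩ := F.affineOpenCover.openCover.exists_eq y
    let j := F.affineOpenCover.f i
    have : IsOpenImmersion j := F.affineOpenCover.map_prop i
    obtain ⟨P, hP⟩ : x ∈ Set.range j := h.mem_open j.isOpenEmbedding.isOpen_range ⟨Q, hQ⟩
    obtain ⟨φ, hφ⟩ := Spec.map_surjective (j ≫ p)
    change j Q = y at hQ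
    rw [← hP, ← hQ] at h ⊢
    have hPQ : P ⤳ Q := j.isOpenEmbedding.isInducing.specializes_iff.mp h
    let := φ.hom.toAlgebra
    have : P.asIdeal.IsPrime := P.isPrime
    have hmax : P.asIdeal.IsMaximal := isMaximal_of_finite_algHom L _ (fun Ω _ _ ↦
      finite_algHom_of_finite_lift p (fun Ω _ γ ↦ (hp Ω γ).1) j φ hφ Ω) P.asIdeal
    rw [PrimeSpectrum.ext (hmax.eq_of_le Q.isPrime.ne_top
      ((PrimeSpectrum.le_iff_specializes P Q).mpr hPQ))]
  exact ⟨⟨hF, inferInstance⟩, (Nat.card_le_card_of_injective s hs').trans hTd⟩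

/-- The scheme `F` is not assumed to be of finite type over `L`: this is a consequence of rigidity, by
`finite_and_isReduced_of_finite_algHom` on affine open subschemes. -/
theorem isFinite_and_isReduced_of_ncard_lift_le (d : ℕ)
    (hp : ∀ (Ω : Type u) [Field Ω] (γ : .of L ⟶ .of Ω),
      {z : Spec (.of Ω) ⟶ F | z ≫ p = Spec.map γ}.Finite ∧
      {z : Spec (.of Ω) ⟶ F | z ≫ p = Spec.map γ}.ncard ≤ d)
    (hrig : ∀ (C : CommRingCat.{u}) [IsLocalRing C] (K : Type u) [Field K] (ι : .of K ⟶ C)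
      (z : Spec C ⟶ F) (z₀ : Spec (.of K) ⟶ F), z ≫ p = (Spec.map ι ≫ z₀) ≫ p →
      Spec.map (CommRingCat.ofHom (IsLocalRing.residue C)) ≫ z =
        Spec.map (CommRingCat.ofHom (IsLocalRing.residue C)) ≫ Spec.map ι ≫ z₀ →
      z = Spec.map ι ≫ z₀) :
    IsFinite p ∧ IsReduced F := by
  have key {R : CommRingCat.{u}} (j : Spec R ⟶ F) [Mono j] (φ : .of L ⟶ R)
      (hφ : Spec.map φ = j ≫ p) :
      letI := φ.hom.toAlgebra
      Module.Finite L R ∧ _root_.IsReduced R := by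
    let := φ.hom.toAlgebra
    refine finite_and_isReduced_of_finite_algHom L R
      (finite_algHom_of_finite_lift p (fun Ω _ γ ↦ (hp Ω γ).1) j φ hφ) ?_
    intro C _ _ _ _ _ hsurj g r
    let K := AlgebraicClosure L
    -- The residue field of `C` is `K`, so the reduction of `g` is a `K`-point `g₀` of `R`.
    let σ : K ≃ₐ[K] IsLocalRing.ResidueField C :=
      AlgEquiv.ofBijective (Algebra.ofId K _) ⟨(algebraMap K _).injective, hsurj⟩
    let g₀ : R →+* K := (σ.symm : _ →+* K).comp ((IsLocalRing.residue C).comp g)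
    let ι : CommRingCat.of K ⟶ .of C := CommRingCat.ofHom (algebraMap K C)
    have h₀ (x : K) : σ x = IsLocalRing.residue C (algebraMap K C x) := rfl
    have hg₀ (a : R) : IsLocalRing.residue C (algebraMap K C (g₀ a)) =
        IsLocalRing.residue C (g a) := by
      rw [← h₀]
      exact σ.apply_symm_apply _
    have hg₀L (a : L) : g₀ (φ.hom a) = algebraMap L K a := by
      apply σ.injective
      refine (hg₀ _).trans ((congr_arg _ (g.commutes a)).trans ?_)
      rw [h₀, ← IsScalarTower.algebraMap_apply]
    have := hrig (.of C) K ι (Spec.map (CommRingCat.ofHom g.toRingHom) ≫ j)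
      (Spec.map (CommRingCat.ofHom g₀) ≫ j) ?_ ?_
    · rw [← Category.assoc, cancel_mono, ← Spec.map_comp] at this
      exact ⟨g₀ r, congr($(Spec.map_injective this).hom r).symm⟩
    · simp only [Category.assoc, ← hφ, ← Spec.map_comp]
      congr 1
      ext a
      refine (g.commutes a).trans ?_
      rw [IsScalarTower.algebraMap_apply L K C, ← hg₀L]
      rfl
    · simp only [← Category.assoc, ← Spec.map_comp]
      congr 2
      ext a
      exact (hg₀ a).symm
  let 𝓤 := F.affineOpenCover
  have hmono (i : 𝓤.I₀) : Mono (𝓤.f i) :=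
    have : IsOpenImmersion (𝓤.f i) := 𝓤.map_prop i
    inferInstance
  have (i : 𝓤.openCover.I₀) : IsAffine (𝓤.openCover.X i) :=
    inferInstanceAs (IsAffine (Spec (𝓤.X i)))
  have hft : LocallyOfFiniteType p := by
    refine HasRingHomProperty.of_source_openCover (P := @LocallyOfFiniteType) 𝓤.openCover fun i ↦ ?_
    obtain ⟨φ, hφ⟩ := Spec.map_surjective (𝓤.f i ≫ p)
    refine (HasRingHomProperty.iff_of_isAffine (P := @LocallyOfFiniteType)).mp ?_
    change LocallyOfFiniteType (𝓤.f i ≫ p)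
    rw [← hφ, HasRingHomProperty.Spec_iff (P := @LocallyOfFiniteType)]
    let := φ.hom.toAlgebra
    have := (@key _ _ (hmono i) φ hφ).1
    exact inferInstanceAs (Algebra.FiniteType L _)
  have hred (i : 𝓤.openCover.I₀) : IsReduced (𝓤.openCover.X i) := by
    obtain ⟨φ, hφ⟩ := Spec.map_surjective (𝓤.f i ≫ p)
    exact (affine_isReduced_iff _).mpr (@key _ _ (hmono i) φ hφ).2
  have := (isTopologicallyFinite_of_ncard_lift_le p d hp).1.1
  have : LocallyQuasiFinite p := .of_finite_preimage_singleton _ fun x ↦ Set.toFinite _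
  have : IsLocallyArtinian (Spec (.of L)) := Scheme.isLocallyArtinianScheme_Spec.mpr
    (inferInstanceAs (IsArtinianRing L))
  exact ⟨.of_locallyQuasiFinite p, IsReduced.of_openCover _ 𝓤.openCover⟩

end Geometric

/-! ### Fibers -/

/-- A point of a fiber of `j ≫ f` with a given structure morphism is determined by its image in `X`,
which is a lift of a given point of `Y`. -/
lemma ncard_fiber_lift_le {Z X Y : Scheme.{u}} (j : Z ⟶ X) [Mono j] (f : X ⟶ Y) (g : Z ⟶ Y)
    (hg : g = j ≫ f) (d : ℕ)
    (h : ∀ (Ω : Type u) [Field Ω] (b : Spec (.of Ω) ⟶ Y),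
      {z : Spec (.of Ω) ⟶ X | z ≫ f = b}.Finite ∧
      {z : Spec (.of Ω) ⟶ X | z ≫ f = b}.ncard ≤ d) (y : Y) (Ω : Type u) [Field Ω]
    (γ : Y.residueField y ⟶ .of Ω) :
    {z : Spec (.of Ω) ⟶ g.fiber y | z ≫ g.fiberToSpecResidueField y = Spec.map γ}.Finite ∧
    {z : Spec (.of Ω) ⟶ g.fiber y | z ≫ g.fiberToSpecResidueField y = Spec.map γ}.ncard ≤ d := by
  obtain ⟨hfin, hcard⟩ := h Ω (Spec.map γ ≫ Y.fromSpecResidueField y)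
  have hmaps : Set.MapsTo (fun z : Spec (.of Ω) ⟶ g.fiber y ↦ z ≫ g.fiberι y ≫ j)
      {z | z ≫ g.fiberToSpecResidueField y = Spec.map γ}
      {z | z ≫ f = Spec.map γ ≫ Y.fromSpecResidueField y} := by
    intro z hz
    change (z ≫ g.fiberι y ≫ j) ≫ f = _
    rw [← hz, Category.assoc, Category.assoc, Category.assoc, ← hg, Scheme.Hom.fiber_fac]
  have hinj : Set.InjOn (fun z : Spec (.of Ω) ⟶ g.fiber y ↦ z ≫ g.fiberι y ≫ j)
      {z | z ≫ g.fiberToSpecResidueField y = Spec.map γ} := by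
    intro z hz z' hz' h
    refine pullback.hom_ext ?_ (hz.trans hz'.symm)
    rw [← cancel_mono j]
    exact (Category.assoc _ _ _).trans (h.trans (Category.assoc _ _ _).symm)
  exact ⟨hfin.of_injOn hmaps hinj, (Set.ncard_le_ncard_of_injOn _ hmaps hinj hfin).trans hcard⟩

end ArcScheme

end

theorem theoremt {k : Type u} [Field k] [PerfectField k] {X Y : Over (Spec (.of k))} (f : X ⟶ Y)
    [LocallyOfFiniteType f.left] [QuasiCompact f.left] [LocallyQuasiFinite f.left]
    [X.left.IsSeparated] [CompactSpace X.left] :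
    (∃ d : ℕ, ∀ β : (arcSpace Y).left,
      IsTopologicallyFinite ((arcSpaceMap f).left.fiber β) ∧
        Nat.card ((arcSpaceMap f).left.fiber β) ≤ d) ∧
    IsClosed (ramificationLocus f.left) ∧
    ∀ (R : Over (Spec (.of k))) (i : R ⟶ X) [IsClosedImmersion i.left],
      Set.range i.left = ramificationLocus f.left →
        ∃ U : (arcSpace X).left.Opens,
          (U : Set (arcSpace X).left) = (Set.range (arcSpaceMap i).left)ᶜ ∧
          ∀ β : (arcSpace Y).left,
            IsFinite ((U.ι ≫ (arcSpaceMap f).left).fiberToSpecResidueField β) ∧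
              IsReduced ((U.ι ≫ (arcSpaceMap f).left).fiber β) := by
  obtain ⟨d, hd⟩ := exists_ncard_arcSpace_lift_le f
  refine ⟨⟨d, fun β ↦ ?_⟩, isClosed_ramificationLocus f.left, fun R i _ hi ↦ ?_⟩
  · exact isTopologicallyFinite_of_ncard_lift_le (L := (arcSpace Y).left.residueField β)
      ((arcSpaceMap f).left.fiberToSpecResidueField β) d
      (ncard_fiber_lift_le (𝟙 _) _ _ (Category.id_comp _).symm d hd β)
  -- Rigidity of the fiber of `U` follows from rigidity of the map of arc spaces on `U`, because a
  -- point of the fiber is determined by its images in `U` and in the residue field.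
  let U : (arcSpace X).left.Opens := ⟨_, (isClosed_range_arcSpaceMap i).isOpen_compl⟩
  let g := U.ι ≫ (arcSpaceMap f).left
  refine ⟨U, rfl, fun β ↦ isFinite_and_isReduced_of_ncard_lift_le
    (L := (arcSpace Y).left.residueField β) (g.fiberToSpecResidueField β) d
    (ncard_fiber_lift_le U.ι _ g rfl d hd β) fun C _ K _ ι z z₀ hz hres ↦ ?_⟩
  refine pullback.hom_ext ?_ hz
  change z ≫ g.fiberι β = (Spec.map ι ≫ z₀) ≫ g.fiberι β
  rw [← cancel_mono U.ι, Category.assoc, Category.assoc, Category.assoc]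
  refine arcSpace_hom_ext_of_isLocalRing f i hi ι (z ≫ g.fiberι β ≫ U.ι)
    (z₀ ≫ g.fiberι β ≫ U.ι) ?_ ?_ fun x ↦ ?_
  · have := congr($hz ≫ (arcSpace Y).left.fromSpecResidueField β)
    simpa only [Category.assoc, ← Scheme.Hom.fiber_fac] using this
  · have := congr($hres ≫ g.fiberι β ≫ U.ι)
    simpa only [Category.assoc] using this
  · rw [← Category.assoc, Scheme.Hom.comp_apply]
    exact ((z₀ ≫ g.fiberι β) x).2
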